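/- Let $C$ be a generalized Cartan matrix of size $n$, that is, an integer $n\times n$ matrix with $c_{ii}=2$, $c_{ij}\le 0$ for $i\ne j$, and $c_{ij}=0\Rightarrow c_{ji}=0$. Let $\mathfrak g$ be the Kac–Moody Lie algebra of $C$ over $\mathbb C$: given a realization of $C$, consisting of a complex vector space $\mathfrak h$ of dimension $2n-\operatorname{rank} C$, linearly independent $\alpha_1^\vee,\dots,\alpha_n^\vee\in\mathfrak h$ and linearly independent $\alpha_1,\dots,\alpha_n\in\mathfrak h^*$ with $\alpha_j(\alpha_i^\vee)=c_{ij}$, it is the quotient of the Lie algebra $\tilde{\mathfrak g}$ generated by $\mathfrak h$ and $e_i,f_i$ ($1\le i\le n$) with relations $[h,h']=0$, $[h,e_i]=\alpha_i(h)e_i$, $[h,f_i]=-\alpha_i(h)f_i$, $[e_i,f_j]=\delta_{ij}\alpha_i^\vee$ ($h,h'\in\mathfrak h$), by the largest ideal of $\tilde{\mathfrak g}$ that intersects $\mathfrak h$ trivially. Let $\mathfrak g'=[\mathfrak g,\mathfrak g]$, let $\mathfrak h'=\mathfrak h\cap\mathfrak g'$, let $\mathfrak h''$ be a vector space complement of $\mathfrak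 h'$ in $\mathfrak h$, and let $N^+$ be the sum of the root spaces of the positive roots of $\mathfrak g$. Let $A$ be a finitely generated commutative associative unital $\mathbb C$-algebra, and let $\mathfrak g_A=(\mathfrak g'\otimes A)\oplus\mathfrak h''$ be the Lie algebra with $[X\otimes a,Y\otimes b]=[X,Y]\otimes ab$, $[X\otimes a,h]=[X,h]\otimes a$ and $[h,k]=0$ for $X,Y\in\mathfrak g'$, $a,b\in A$, $h,k\in\mathfrak h''$. The element $x+y$ of $\mathfrak h=\mathfrak h'\oplus\mathfrak h''$ is regarded as the element $x\otimes 1+y$ of $\mathfrak g_A$. Let $\psi:(\mathfrak h'\otimes A)\oplus\mathfrak h''\to\mathbb C$ be a linear map, let $B=(N^+\otimes A)\oplus(\mathfrak h'\otimes A)\oplus\mathfrak h''$, let $\mathbb C(\psi)$ be the one-dimensional $B$-module on which $N^+\otimes A$ acts by $0$ and $(\mathfrak h'\otimes A)\oplus\mathfrak h''$ acts by $\psi$, and let $V(\psi)$ be the unique irreducible quotient of the induced module $M(\psi)=U(\mathfrak g_A)\otimes_{U(B)}\mathbb C(\psi)$. Then all weight spaces $V(\psi)_\mu=\{v\in V(\psi):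 hv=\mu(h)v \text{ for all } h\in\mathfrak h\}$, $\mu\in\mathfrak h^*$, are finite-dimensional if and only if there is an ideal $I$ of $A$ with $\dim_{\mathbb C}A/I<\infty$ such that $\psi(\mathfrak h'\otimes I)=0$. -/

import Mathlib

open scoped TensorProduct

universe uι uH uA

/-- Generalized Cartan matrices: integer matrices with `2` on the diagonal, non-positive entries
off the diagonal, and zeros placed symmetrically. -/
structure IsGeneralizedCartanMatrix {ι : Type uι} (C : Matrix ι ι ℤ) : Prop where
  diag : ∀ i, C i i = 2
  offDiag : ∀ i j, i ≠ j → C i j ≤ 0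
  zero_symm : ∀ i j, C i j = 0 → C j i = 0

/-- A (minimal) realization `(H, Π, Π^∨)` of the square matrix `C` over `ℂ`: linearly independent
simple coroots in `H` and simple roots in the dual of `H`, paired by `C`, with
`dim H = 2 n - rank C`. -/
structure CartanRealization {ι : Type uι} [Fintype ι] (C : Matrix ι ι ℤ)
    (H : Type uH) [AddCommGroup H] [Module ℂ H] where
  coroot : ι → H
  root : ι → Module.Dual ℂ H
  linearIndependent_coroot : LinearIndependent ℂ coroot
  linearIndependent_root : LinearIndependent ℂ root
  root_coroot : ∀ i j, root j (coroot i) = (C i j : ℂ)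
  finiteDimensional : FiniteDimensional ℂ H
  finrank_add_rank :
    Module.finrank ℂ H + (C.map (Int.cast : ℤ → ℂ)).rank = 2 * Fintype.card ι

namespace LieIdeal

variable {L : Type*} [LieRing L] [LieAlgebra ℂ L]

/-- The action of a Lie algebra on one of its ideals by (restrictions of) inner derivations. -/
noncomputable def adDerivation (I : LieIdeal ℂ L) : L →ₗ⁅ℂ⁆ LieDerivation ℂ I I where
  toFun x :=
    { toLinearMap := LieModule.toEnd ℂ L I x
      leibniz' := fun a b => by
        apply Subtype.ext
        change ⁅x, ⁅(a : L), (b : L)⁆⁆ = ⁅(a : L), ⁅x, (b : L)⁆⁆ - ⁅(b : L), ⁅x, (a : L)⁆⁆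
        rw [leibniz_lie x (a : L), ← lie_skew (b : L)]
        abel }
  map_add' x y := by ext; simp
  map_smul' c x := by ext; simp
  map_lie' := by
    intro x y
    ext z
    simp

end LieIdeal

namespace CartanRealization

noncomputable section

variable {ι : Type uι} [Fintype ι] {C : Matrix ι ι ℤ}
  {H : Type uH} [AddCommGroup H] [Module ℂ H]

/-- The generators `e i`, `f i` and `h x`, `x ∈ H`. -/
inductive Gen (ι : Type uι) (H : Type uH) : Type (max uι uH)
  | e : ι → Gen ι H
  | f : ι → Gen ι H
  | h : H → Gen ι H

/-- The generator `e i` of the free Lie algebra. -/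
def genE (H : Type uH) (i : ι) : FreeLieAlgebra ℂ (Gen ι H) := FreeLieAlgebra.of ℂ (Gen.e i)

/-- The generator `f i` of the free Lie algebra. -/
def genF (H : Type uH) (i : ι) : FreeLieAlgebra ℂ (Gen ι H) := FreeLieAlgebra.of ℂ (Gen.f i)

/-- The generator `h x` of the free Lie algebra. -/
def genH (ι : Type uι) (x : H) : FreeLieAlgebra ℂ (Gen ι H) := FreeLieAlgebra.of ℂ (Gen.h x)

/-- The defining relations of the auxiliary Lie algebra of a realization. The first two make
`x ↦ h x` linear. -/
inductive AuxRel (R : CartanRealization C H) : FreeLieAlgebra ℂ (Gen ι H) → Prop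
  | h_add (x y : H) : AuxRel R (genH ι (x + y) - (genH ι x + genH ι y))
  | h_smul (c : ℂ) (x : H) : AuxRel R (genH ι (c • x) - c • genH ι x)
  | h_h (x y : H) : AuxRel R ⁅genH ι x, genH ι y⁆
  | h_e (x : H) (i : ι) : AuxRel R (⁅genH ι x, genE H i⁆ - R.root i x • genE H i)
  | h_f (x : H) (i : ι) : AuxRel R (⁅genH ι x, genF H i⁆ + R.root i x • genF H i)
  | e_f_same (i : ι) : AuxRel R (⁅genE H i, genF H i⁆ - genH ι (R.coroot i))
  | e_f_ne (i j : ι) (hij : i ≠ j) : AuxRel R ⁅genE H i, genF H j⁆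

/-- The ideal generated by the defining relations. -/
def relIdeal (R : CartanRealization C H) : LieIdeal ℂ (FreeLieAlgebra ℂ (Gen ι H)) :=
  LieSubmodule.lieSpan ℂ _ {r | AuxRel R r}

/-- The auxiliary Lie algebra `g̃(C)`. -/
abbrev Aux (R : CartanRealization C H) : Type (max uι uH) :=
  FreeLieAlgebra ℂ (Gen ι H) ⧸ R.relIdeal

/-- The canonical linear map from `H` to the auxiliary Lie algebra. -/
def toAux (R : CartanRealization C H) : H →ₗ[ℂ] R.Aux where
  toFun x := LieSubmodule.Quotient.mk (genH ι x)
  map_add' x y := (Submodule.Quotient.eq _).2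
    (LieSubmodule.subset_lieSpan (AuxRel.h_add (R := R) x y))
  map_smul' c x := (Submodule.Quotient.eq _).2
    (LieSubmodule.subset_lieSpan (AuxRel.h_smul (R := R) c x))

/-- The largest ideal of `g̃(C)` intersecting `H` trivially, as the sum of all such ideals. -/
def radIdeal (R : CartanRealization C H) : LieIdeal ℂ R.Aux :=
  sSup {I | I.toSubmodule ⊓ LinearMap.range R.toAux = ⊥}

/-- The Kac-Moody Lie algebra `g = g(C)`. -/
abbrev KacMoody (R : CartanRealization C H) : Type (max uι uH) :=
  R.Aux ⧸ R.radIdeal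

/-- The canonical linear map from `H` to `g`. -/
def toKacMoody (R : CartanRealization C H) : H →ₗ[ℂ] R.KacMoody :=
  (LieSubmodule.Quotient.mk' R.radIdeal : R.Aux →ₗ[ℂ] R.KacMoody) ∘ₗ R.toAux

/-- The Cartan subalgebra `h` of `g`. -/
def cartan (R : CartanRealization C H) : Submodule ℂ R.KacMoody :=
  LinearMap.range R.toKacMoody

/-- The derived algebra `g' = [g, g]`. -/
def derived (R : CartanRealization C H) : LieIdeal ℂ R.KacMoody :=
  ⁅(⊤ : LieIdeal ℂ R.KacMoody), (⊤ : LieIdeal ℂ R.KacMoody)⁆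

/-- `h' = h ∩ g'`, as a subspace of `g'`. -/
def cartanDerived (R : CartanRealization C H) : Submodule ℂ R.derived :=
  R.cartan.comap R.derived.toSubmodule.subtype

/-- The subspace of all `x ∈ g` with `[h, x] = μ(h) x` for all `h`. -/
def rootSpace (R : CartanRealization C H) (μ : Module.Dual ℂ H) : Submodule ℂ R.KacMoody where
  carrier := {x | ∀ h : H, ⁅R.toKacMoody h, x⁆ = μ h • x}
  zero_mem' h := by simp
  add_mem' {x y} hx hy h := by simp [hx h, hy h]
  smul_mem' c x hx h := by simp [hx h, smul_comm c]

/-- `N⁺`, the sum of the root spaces of all positive roots, as a subspace of `g'`. (For a nonzero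
`n : ι → ℕ` such that `∑ n i • α i` is not a root the summand is zero.) -/
def nPos (R : CartanRealization C H) : Submodule ℂ R.derived :=
  (⨆ n : {n : ι → ℕ // n ≠ 0}, R.rootSpace (∑ i, n.1 i • R.root i)).comap
    R.derived.toSubmodule.subtype

/-- `K = h''` is a vector space complement of `h'` in `h`. (As `h` is abelian, every subspace of
`h` is a Lie subalgebra of `g`.) -/
structure IsComplement (R : CartanRealization C H) (K : LieSubalgebra ℂ R.KacMoody) : Prop where
  disjoint : (R.cartan ⊓ R.derived.toSubmodule) ⊓ K.toSubmodule = ⊥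
  sup_eq : (R.cartan ⊓ R.derived.toSubmodule) ⊔ K.toSubmodule = R.cartan

variable (A : Type uA) [CommRing A] [Algebra ℂ A]

/-- The action of `K = h''` on `A ⊗ g'` by derivations, `y ↦ (a ⊗ x ↦ a ⊗ [y, x])`. -/
def currentAction (R : CartanRealization C H) (K : LieSubalgebra ℂ R.KacMoody) :
    K →ₗ⁅ℂ⁆ LieDerivation ℂ (A ⊗[ℂ] R.derived) (A ⊗[ℂ] R.derived) :=
  ((Lie.Derivation.ofLieDerivation A).comp R.derived.adDerivation).comp K.incl

/-- The current Kac-Moody Lie algebra `g_A = (A ⊗ g') ⊕ h''`. -/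
abbrev Current (R : CartanRealization C H) (K : LieSubalgebra ℂ R.KacMoody) :
    Type (max uι uH uA) :=
  LieAlgebra.SemiDirectSum (A ⊗[ℂ] R.derived) K (R.currentAction A K)

/-- The enveloping algebra `U(g_A)`. -/
abbrev CurrentU (R : CartanRealization C H) (K : LieSubalgebra ℂ R.KacMoody) :
    Type (max uι uH uA) :=
  UniversalEnvelopingAlgebra ℂ (R.Current A K)

/-- The inclusion of `(A ⊗ h') ⊕ h''` in `g_A`. -/
def currentCartan (R : CartanRealization C H) (K : LieSubalgebra ℂ R.KacMoody)
    (t : (A ⊗[ℂ] R.cartanDerived) × K) : R.Current A K :=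
  ⟨R.cartanDerived.subtype.lTensor A t.1, t.2⟩

variable {A}

/-- The left ideal of `U(g_A)` generated by `N⁺ ⊗ A` and by all `h - ψ(h)` with
`h ∈ (A ⊗ h') ⊕ h''`, that is, the left ideal generated by the kernel of the
action of `U(B)` on the one-dimensional module `ℂ(ψ)`. -/
def vermaIdeal {R : CartanRealization C H} {K : LieSubalgebra ℂ R.KacMoody}
    (ψ : ((A ⊗[ℂ] R.cartanDerived) × K) →ₗ[ℂ] ℂ) : Submodule (R.CurrentU A K) (R.CurrentU A K) :=
  Submodule.span _
    ({u | ∃ (a : A) (x : R.derived), x ∈ R.nPos ∧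
        u = UniversalEnvelopingAlgebra.ι ℂ (⟨a ⊗ₜ[ℂ] x, 0⟩ : R.Current A K)} ∪
      {u | ∃ t : (A ⊗[ℂ] R.cartanDerived) × K,
        u = UniversalEnvelopingAlgebra.ι ℂ (R.currentCartan A K t) -
          algebraMap ℂ (R.CurrentU A K) (ψ t)})

/-- The induced module `M(ψ) = U(g_A) ⊗_{U(B)} ℂ(ψ)`, as the quotient of `U(g_A)` by a left
ideal. -/
abbrev Verma {R : CartanRealization C H} {K : LieSubalgebra ℂ R.KacMoody}
    (ψ : ((A ⊗[ℂ] R.cartanDerived) × K) →ₗ[ℂ] ℂ) : Type (max uι uH uA) :=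
  R.CurrentU A K ⧸ vermaIdeal ψ

/-- The largest proper submodule of `M(ψ)`, as the sum of all proper submodules. -/
def maxSubmodule {R : CartanRealization C H} {K : LieSubalgebra ℂ R.KacMoody}
    (ψ : ((A ⊗[ℂ] R.cartanDerived) × K) →ₗ[ℂ] ℂ) : Submodule (R.CurrentU A K) (Verma ψ) :=
  sSup {N | N ≠ ⊤}

/-- The irreducible quotient `V(ψ)` of `M(ψ)`. -/
abbrev Irr {R : CartanRealization C H} {K : LieSubalgebra ℂ R.KacMoody}
    (ψ : ((A ⊗[ℂ] R.cartanDerived) × K) →ₗ[ℂ] ℂ) : Type (max uι uH uA) :=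
  Verma ψ ⧸ maxSubmodule ψ

/-- The weight space of `V(ψ)` of weight `μ ∈ h^*`. An element `z = x + y` of `h = h' ⊕ h''` is
the element `1 ⊗ x + y` of `g_A`. -/
def weightSpace {R : CartanRealization C H} {K : LieSubalgebra ℂ R.KacMoody}
    (ψ : ((A ⊗[ℂ] R.cartanDerived) × K) →ₗ[ℂ] ℂ) (μ : Module.Dual ℂ R.cartan) :
    Submodule ℂ (Irr ψ) where
  carrier := {v | ∀ (z : R.cartan) (x : R.cartanDerived) (y : K),
    (z : R.KacMoody) = ((x : R.derived) : R.KacMoody) + (y : R.KacMoody) →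
      UniversalEnvelopingAlgebra.ι ℂ (R.currentCartan A K ((1 : A) ⊗ₜ[ℂ] x, y)) • v = μ z • v}
  zero_mem' z x y _ := by simp
  add_mem' {v w} hv hw z x y h := by rw [smul_add, smul_add, hv z x y h, hw z x y h]
  smul_mem' c v hv z x y h := by
    rw [smul_comm, hv z x y h, smul_comm]

end

end CartanRealization

/-! Let `v` be the highest weight vector of $V(\psi)$. If the weight spaces are finite-dimensional,
let $I$ be the set of $a$ with $(f_i\otimes a)v=0$ for all $i$. For fixed $i$ the vectors
$(f_i\otimes a)v$ lie in a single weight space, so $I$ has finite codimension. Applying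
$\alpha_i^\vee\otimes b$ to $(f_i\otimes a)v=0$ leaves $-2(f_i\otimes ba)v=0$, so $I$ is an ideal.
Applying $e_i\otimes 1$ gives $\psi(\alpha_i^\vee\otimes a)v=0$; since $v\ne0$ and the coroots span
$\mathfrak h'$, $\psi$ vanishes on $\mathfrak h'\otimes I$ (`exists_ideal_of_finiteDimensional`).

Conversely, if $\psi(\mathfrak h'\otimes I)=0$, the ideal $\mathfrak g'\otimes I$ sends the highest
weight vector of $M(\psi)$ strictly below itself, hence sends all of $M(\psi)$ there. The submodule
it generates is proper, so $\mathfrak g'\otimes I$ annihilates $V(\psi)$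
(`rep_irr_eq_zero_of_idealCurrent`). The operators $f_i\otimes a$ then depend only on $a$ modulo
$I$, so products of $k$ of them applied to `v` span a finite-dimensional space. With $h$ chosen so
that all $\alpha_i(h)=1$, these spaces lie in different eigenspaces of $h$, and each weight space
lies in one eigenspace (`finiteDimensional_weightSpace`).

Both directions need $M(\psi)\ne0$ (`vermaVector_ne_zero`). Instead of a Poincaré–Birkhoff–Witt
basis, the proof uses the tensor algebra on letters $f_i\otimes a$: the commutation relations
dictate how $e_i\otimes a$ and the Cartan part act on words. These operators satisfy the Chevalley
relations but not necessarily the other relations of $\mathfrak g_A$. The pairs (generator,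
operator) therefore generate a Lie algebra that maps onto $\mathfrak g_A$ with a possibly nonzero
kernel. By the triangular decomposition, values of kernel operators have no constant term, so the
empty word survives when these values are divided out. -/

/-! ### Sums of eigenspaces of an endomorphism -/

namespace Module.End

variable {V : Type*} [AddCommGroup V] [Module ℂ V]

/-- The sum of the eigenspaces of `φ` with eigenvalues in `I`. -/
def eigenSum (φ : Module.End ℂ V) (I : Set ℂ) : Submodule ℂ V := ⨆ μ ∈ I, φ.eigenspace μ

theorem eigenspace_le_eigenSum (φ : Module.End ℂ V) {I : Set ℂ} {μ : ℂ} (h : μ ∈ I) :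
    φ.eigenspace μ ≤ φ.eigenSum I :=
  le_biSup (fun μ => φ.eigenspace μ) h

theorem disjoint_eigenSum (φ : Module.End ℂ V) {I J : Set ℂ} (h : Disjoint I J) :
    Disjoint (φ.eigenSum I) (φ.eigenSum J) :=
  φ.eigenspaces_iSupIndep.disjoint_biSup_biSup h

theorem eigenSum_le_iff {φ : Module.End ℂ V} {I : Set ℂ} {p : Submodule ℂ V} :
    φ.eigenSum I ≤ p ↔ ∀ μ ∈ I, φ.eigenspace μ ≤ p :=
  iSup₂_le_iff

theorem eigenSum_mono (φ : Module.End ℂ V) {I J : Set ℂ} (h : I ⊆ J) :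
    φ.eigenSum I ≤ φ.eigenSum J :=
  eigenSum_le_iff.2 fun _ hμ => φ.eigenspace_le_eigenSum (h hμ)

theorem eq_zero_of_add_eq_zero {φ : Module.End ℂ V} {I J : Set ℂ} (h : Disjoint I J) {x y : V}
    (hx : x ∈ φ.eigenSum I) (hy : y ∈ φ.eigenSum J) (hxy : x + y = 0) : x = 0 :=
  Submodule.disjoint_def.1 (φ.disjoint_eigenSum h) x hx
    (eq_neg_of_add_eq_zero_left hxy ▸ neg_mem hy)

/-- An invariant subspace contains the components of its elements in eigenspaces. -/
theorem mem_of_add_mem_of_invariant {φ : Module.End ℂ V} {p : Submodule ℂ V}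
    (hp : ∀ x ∈ p, φ x ∈ p) {μ : ℂ} {I : Set ℂ} (hμ : μ ∉ I) {x y : V}
    (hx : x ∈ φ.eigenspace μ) (hy : y ∈ φ.eigenSum I) (hxy : x + y ∈ p) : x ∈ p := by
  -- In the quotient by `p` the images of `x` and `y` add up to zero but have disjoint eigenvalues,
  -- so both vanish.
  let q : Module.End ℂ (V ⧸ p) := p.mapQ p φ hp
  have key : ∀ ν, ∀ z ∈ φ.eigenspace ν, p.mkQ z ∈ q.eigenspace ν := fun ν z hz => by
    rw [Module.End.mem_eigenspace_iff] at hz ⊢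
    change p.mkQ (φ z) = _
    rw [hz, map_smul]
  have hy' : p.mkQ y ∈ q.eigenSum I :=
    (eigenSum_le_iff (p := (q.eigenSum I).comap p.mkQ)).2
      (fun ν hν z hz => q.eigenspace_le_eigenSum hν (key ν z hz)) hy
  have hx' : p.mkQ x ∈ q.eigenSum {μ} :=
    q.eigenspace_le_eigenSum (Set.mem_singleton μ) (key μ x hx)
  have h0 : p.mkQ x + p.mkQ y = 0 := by
    rw [← map_add]; exact (Submodule.Quotient.mk_eq_zero p).2 hxy
  exact (Submodule.Quotient.mk_eq_zero p).1
    (eq_zero_of_add_eq_zero (Set.disjoint_singleton_left.2 hμ) hx' hy' h0)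

end Module.End

/-! ### Chevalley generators with coefficients, and triangular decomposition (used for both `g` and
`g_A`) -/

/-- Roots with values in `A` and coroots with coefficients in `A` for an abelian Lie algebra `T`. -/
structure RootDatumOver (ι A T : Type*) [CommRing A] [Algebra ℂ A] [AddCommGroup T]
    [Module ℂ T] where
  root : ι → T →ₗ[ℂ] A
  coroot : ι → A →ₗ[ℂ] T

/-- Elements `e i a`, `f i a` and `t s` of a Lie algebra satisfying the Chevalley relations with
coefficients in `A`. -/
structure ChevalleyGenerators {ι A T : Type*} [CommRing A] [Algebra ℂ A] [AddCommGroup T]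
    [Module ℂ T] (D : RootDatumOver ι A T) (L : Type*) [LieRing L] [LieAlgebra ℂ L] where
  e : ι → A →ₗ[ℂ] L
  f : ι → A →ₗ[ℂ] L
  t : T →ₗ[ℂ] L
  e_f_same : ∀ i a b, ⁅e i a, f i b⁆ = t (D.coroot i (a * b))
  e_f_ne : ∀ i j a b, i ≠ j → ⁅e i a, f j b⁆ = 0
  t_e : ∀ s i a, ⁅t s, e i a⁆ = e i (D.root i s * a)
  t_f : ∀ s i a, ⁅t s, f i a⁆ = -f i (D.root i s * a)
  t_t : ∀ s s', ⁅t s, t s'⁆ = 0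

namespace ChevalleyGenerators

open Module.End

variable {ι A T : Type*} [CommRing A] [Algebra ℂ A] [AddCommGroup T] [Module ℂ T]
  {D : RootDatumOver ι A T} {L : Type*} [LieRing L] [LieAlgebra ℂ L]

/-- The subalgebra generated by the `e i a`. -/
def upper (G : ChevalleyGenerators D L) : LieSubalgebra ℂ L :=
  LieSubalgebra.lieSpan ℂ L {x | ∃ i a, x = G.e i a}

/-- The subalgebra generated by the `f i a`. -/
def lower (G : ChevalleyGenerators D L) : LieSubalgebra ℂ L :=
  LieSubalgebra.lieSpan ℂ L {x | ∃ i a, x = G.f i a}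

/-- The subalgebra generated by all `e i a`, `f i a` and `t s`. -/
def generated (G : ChevalleyGenerators D L) : LieSubalgebra ℂ L :=
  LieSubalgebra.lieSpan ℂ L ({x | ∃ i a, x = G.e i a} ∪ {x | ∃ i a, x = G.f i a} ∪ Set.range G.t)

variable (G : ChevalleyGenerators D L)

theorem e_mem_upper (i a) : G.e i a ∈ G.upper := LieSubalgebra.subset_lieSpan ⟨i, a, rfl⟩

theorem f_mem_lower (i a) : G.f i a ∈ G.lower := LieSubalgebra.subset_lieSpan ⟨i, a, rfl⟩

theorem e_mem_generated (i a) : G.e i a ∈ G.generated :=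
  LieSubalgebra.subset_lieSpan (Or.inl (Or.inl ⟨i, a, rfl⟩))

theorem f_mem_generated (i a) : G.f i a ∈ G.generated :=
  LieSubalgebra.subset_lieSpan (Or.inl (Or.inr ⟨i, a, rfl⟩))

theorem t_mem_generated (s) : G.t s ∈ G.generated :=
  LieSubalgebra.subset_lieSpan (Or.inr ⟨s, rfl⟩)

theorem upper_le {P : LieSubalgebra ℂ L} (h : ∀ i a, G.e i a ∈ P) : G.upper ≤ P :=
  LieSubalgebra.lieSpan_le.2 (by rintro _ ⟨i, a, rfl⟩; exact h i a)

theorem lower_le {P : LieSubalgebra ℂ L} (h : ∀ i a, G.f i a ∈ P) : G.lower ≤ P :=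
  LieSubalgebra.lieSpan_le.2 (by rintro _ ⟨i, a, rfl⟩; exact h i a)

theorem generated_le {P : LieSubalgebra ℂ L} (he : ∀ i a, G.e i a ∈ P) (hf : ∀ i a, G.f i a ∈ P)
    (ht : ∀ s, G.t s ∈ P) : G.generated ≤ P :=
  LieSubalgebra.lieSpan_le.2 (by
    rintro _ ((⟨i, a, rfl⟩ | ⟨i, a, rfl⟩) | ⟨s, rfl⟩)
    exacts [he i a, hf i a, ht s])

theorem lie_t_mem_upper (s : T) {x : L} (hx : x ∈ G.upper) : ⁅G.t s, x⁆ ∈ G.upper := by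
  induction hx using LieSubalgebra.lieSpan_induction with
  | mem x hx => obtain ⟨i, a, rfl⟩ := hx; rw [G.t_e]; exact G.e_mem_upper _ _
  | zero => rw [lie_zero]; exact zero_mem _
  | add x y _ _ hx hy => rw [lie_add]; exact add_mem hx hy
  | smul c x _ hx => rw [lie_smul]; exact G.upper.smul_mem c hx
  | lie x y hx' hy' hx hy =>
    rw [leibniz_lie]; exact add_mem (G.upper.lie_mem hx hy') (G.upper.lie_mem hx' hy)

theorem lie_t_mem_lower (s : T) {x : L} (hx : x ∈ G.lower) : ⁅G.t s, x⁆ ∈ G.lower := by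
  induction hx using LieSubalgebra.lieSpan_induction with
  | mem x hx => obtain ⟨i, a, rfl⟩ := hx; rw [G.t_f]; exact neg_mem (G.f_mem_lower _ _)
  | zero => rw [lie_zero]; exact zero_mem _
  | add x y _ _ hx hy => rw [lie_add]; exact add_mem hx hy
  | smul c x _ hx => rw [lie_smul]; exact G.lower.smul_mem c hx
  | lie x y hx' hy' hx hy =>
    rw [leibniz_lie]; exact add_mem (G.lower.lie_mem hx hy') (G.lower.lie_mem hx' hy)

/-- The span of all coroots. -/
def corootSpan (D : RootDatumOver ι A T) : Submodule ℂ T := ⨆ i, LinearMap.range (D.coroot i)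

theorem coroot_mem_corootSpan (i : ι) (a : A) : D.coroot i a ∈ corootSpan D :=
  Submodule.mem_iSup_of_mem (p := fun i => LinearMap.range (D.coroot i)) i ⟨a, rfl⟩

/-- `lower + t Q + upper`. -/
def triangular (Q : Submodule ℂ T) : Submodule ℂ L :=
  G.lower.toSubmodule ⊔ Q.map G.t ⊔ G.upper.toSubmodule

variable {G} in
theorem mem_triangular {Q : Submodule ℂ T} {x : L} :
    x ∈ G.triangular Q ↔ ∃ y ∈ G.lower, ∃ s ∈ Q, ∃ z ∈ G.upper, y + G.t s + z = x := by
  simp only [triangular, Submodule.mem_sup, Submodule.mem_map, LieSubalgebra.mem_toSubmodule]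
  constructor
  · rintro ⟨_, ⟨y, hy, _, ⟨s, hs, rfl⟩, rfl⟩, z, hz, rfl⟩
    exact ⟨y, hy, s, hs, z, hz, rfl⟩
  · rintro ⟨y, hy, s, hs, z, hz, rfl⟩
    exact ⟨_, ⟨y, hy, _, ⟨s, hs, rfl⟩, rfl⟩, z, hz, rfl⟩

theorem lower_le_triangular (Q : Submodule ℂ T) : G.lower.toSubmodule ≤ G.triangular Q :=
  le_sup_left.trans le_sup_left

theorem upper_le_triangular (Q : Submodule ℂ T) : G.upper.toSubmodule ≤ G.triangular Q :=
  le_sup_right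

theorem t_mem_triangular {Q : Submodule ℂ T} {s : T} (hs : s ∈ Q) : G.t s ∈ G.triangular Q :=
  le_sup_left (a := G.lower.toSubmodule ⊔ Q.map G.t)
    (le_sup_right (a := G.lower.toSubmodule) (Submodule.mem_map_of_mem hs))

theorem lie_t_mem_triangular (Q : Submodule ℂ T) (s : T) {x : L} (hx : x ∈ G.triangular Q) :
    ⁅G.t s, x⁆ ∈ G.triangular Q := by
  obtain ⟨y, hy, s', _, z, hz, rfl⟩ := mem_triangular.1 hx
  rw [lie_add, lie_add, G.t_t, add_zero]
  exact add_mem (G.lower_le_triangular Q (G.lie_t_mem_lower s hy))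
    (G.upper_le_triangular Q (G.lie_t_mem_upper s hz))

/-- Only a bracket of `e` with a single `f` leaves `lower`. In a longer bracket the Leibniz rule
pairs the resulting coroot with another element of `lower`, and `lower` is stable under `t`. -/
theorem lie_e_lower_mem (i : ι) (a : A) {x : L} (hx : x ∈ G.lower) :
    ⁅G.e i a, x⁆ ∈ G.lower.toSubmodule ⊔ (corootSpan D).map G.t := by
  have aux : ∀ u ∈ G.lower.toSubmodule ⊔ (corootSpan D).map G.t, ∀ y ∈ G.lower,
      ⁅u, y⁆ ∈ G.lower := by
    intro u hu y hy
    obtain ⟨l, hl, _, ⟨s, _, rfl⟩, rfl⟩ := Submodule.mem_sup.1 hu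
    rw [add_lie]
    exact add_mem (G.lower.lie_mem hl hy) (G.lie_t_mem_lower s hy)
  induction hx using LieSubalgebra.lieSpan_induction with
  | mem x hx =>
    obtain ⟨j, b, rfl⟩ := hx
    by_cases hij : i = j
    · subst hij
      rw [G.e_f_same]
      exact Submodule.mem_sup_right (Submodule.mem_map_of_mem (coroot_mem_corootSpan _ _))
    · rw [G.e_f_ne _ _ _ _ hij]; exact zero_mem _
  | zero => rw [lie_zero]; exact zero_mem _
  | add x y _ _ hx hy => rw [lie_add]; exact add_mem hx hy
  | smul c x _ hx => rw [lie_smul]; exact Submodule.smul_mem _ c hx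
  | lie x y hx' hy' hx hy =>
    rw [leibniz_lie, ← lie_skew x]
    exact Submodule.mem_sup_left (add_mem (aux _ hx _ hy') (neg_mem (aux _ hy _ hx')))

theorem lie_f_upper_mem (i : ι) (a : A) {x : L} (hx : x ∈ G.upper) :
    ⁅G.f i a, x⁆ ∈ G.upper.toSubmodule ⊔ (corootSpan D).map G.t := by
  have aux : ∀ u ∈ G.upper.toSubmodule ⊔ (corootSpan D).map G.t, ∀ y ∈ G.upper,
      ⁅u, y⁆ ∈ G.upper := by
    intro u hu y hy
    obtain ⟨l, hl, _, ⟨s, _, rfl⟩, rfl⟩ := Submodule.mem_sup.1 hu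
    rw [add_lie]
    exact add_mem (G.upper.lie_mem hl hy) (G.lie_t_mem_upper s hy)
  induction hx using LieSubalgebra.lieSpan_induction with
  | mem x hx =>
    obtain ⟨j, b, rfl⟩ := hx
    rw [← lie_skew]
    refine neg_mem ?_
    by_cases hij : j = i
    · subst hij
      rw [G.e_f_same]
      exact Submodule.mem_sup_right (Submodule.mem_map_of_mem (coroot_mem_corootSpan _ _))
    · rw [G.e_f_ne _ _ _ _ hij]; exact zero_mem _
  | zero => rw [lie_zero]; exact zero_mem _
  | add x y _ _ hx hy => rw [lie_add]; exact add_mem hx hy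
  | smul c x _ hx => rw [lie_smul]; exact Submodule.smul_mem _ c hx
  | lie x y hx' hy' hx hy =>
    rw [leibniz_lie, ← lie_skew x]
    exact Submodule.mem_sup_left (add_mem (aux _ hx _ hy') (neg_mem (aux _ hy _ hx')))

theorem lie_e_mem_triangular {Q : Submodule ℂ T} (hQ : corootSpan D ≤ Q) (i : ι) (a : A) {x : L}
    (hx : x ∈ G.triangular Q) : ⁅G.e i a, x⁆ ∈ G.triangular Q := by
  obtain ⟨y, hy, s, _, z, hz, rfl⟩ := mem_triangular.1 hx
  rw [lie_add, lie_add, ← lie_skew _ (G.t s), G.t_e]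
  refine add_mem (add_mem ?_ ?_) ?_
  · have h : G.lower.toSubmodule ⊔ (corootSpan D).map G.t ≤ G.triangular Q :=
      sup_le (G.lower_le_triangular Q)
        ((Submodule.map_mono hQ).trans (le_sup_right.trans le_sup_left))
    exact h (G.lie_e_lower_mem i a hy)
  · exact neg_mem (G.upper_le_triangular Q (G.e_mem_upper _ _))
  · exact G.upper_le_triangular Q (G.upper.lie_mem (G.e_mem_upper i a) hz)

theorem lie_f_mem_triangular {Q : Submodule ℂ T} (hQ : corootSpan D ≤ Q) (i : ι) (a : A) {x : L}
    (hx : x ∈ G.triangular Q) : ⁅G.f i a, x⁆ ∈ G.triangular Q := by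
  obtain ⟨y, hy, s, _, z, hz, rfl⟩ := mem_triangular.1 hx
  rw [lie_add, lie_add, ← lie_skew _ (G.t s), G.t_f, neg_neg]
  refine add_mem (add_mem ?_ ?_) ?_
  · exact G.lower_le_triangular Q (G.lower.lie_mem (G.f_mem_lower i a) hy)
  · exact G.lower_le_triangular Q (G.f_mem_lower _ _)
  · have h : G.upper.toSubmodule ⊔ (corootSpan D).map G.t ≤ G.triangular Q :=
      sup_le le_sup_right ((Submodule.map_mono hQ).trans (le_sup_right.trans le_sup_left))
    exact h (G.lie_f_upper_mem i a hz)

/-- `Q` is kept free for two uses: `⊤` yields the triangular decomposition of the whole generated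
algebra, `corootSpan D` that of its derived algebra. -/
theorem lie_mem_triangular {Q : Submodule ℂ T} (hQ : corootSpan D ≤ Q) {x y : L}
    (hx : x ∈ G.generated) (hy : y ∈ G.triangular Q) : ⁅x, y⁆ ∈ G.triangular Q := by
  induction hx using LieSubalgebra.lieSpan_induction generalizing y with
  | mem x hx =>
    obtain (⟨i, a, rfl⟩ | ⟨i, a, rfl⟩) | ⟨s, rfl⟩ := hx
    exacts [G.lie_e_mem_triangular hQ i a hy, G.lie_f_mem_triangular hQ i a hy,
      G.lie_t_mem_triangular Q s hy]
  | zero => rw [zero_lie]; exact zero_mem _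
  | add x z _ _ hx hz => rw [add_lie]; exact add_mem (hx hy) (hz hy)
  | smul c x _ hx => rw [smul_lie]; exact Submodule.smul_mem _ c (hx hy)
  | lie x z _ _ hx hz => rw [lie_lie]; exact sub_mem (hx (hz hy)) (hz (hx hy))

theorem generated_le_triangular : G.generated.toSubmodule ≤ G.triangular ⊤ := by
  intro x hx
  induction hx using LieSubalgebra.lieSpan_induction with
  | mem x hx =>
    obtain (⟨i, a, rfl⟩ | ⟨i, a, rfl⟩) | ⟨s, rfl⟩ := hx
    exacts [G.upper_le_triangular _ (G.e_mem_upper i a),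
      G.lower_le_triangular _ (G.f_mem_lower i a), G.t_mem_triangular trivial]
  | zero => exact zero_mem _
  | add x z _ _ hx hz => exact add_mem hx hz
  | smul c x _ hx => exact Submodule.smul_mem _ c hx
  | lie x z hx _ _ hz => exact G.lie_mem_triangular le_top hx hz

theorem exists_decomposition {x : L} (hx : x ∈ G.generated) :
    ∃ y ∈ G.lower, ∃ s, ∃ z ∈ G.upper, y + G.t s + z = x := by
  obtain ⟨y, hy, s, _, z, hz, h⟩ := mem_triangular.1 (G.generated_le_triangular hx)
  exact ⟨y, hy, s, z, hz, h⟩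

theorem lower_le_generated : G.lower ≤ G.generated := G.lower_le G.f_mem_generated

theorem upper_le_generated : G.upper ≤ G.generated := G.upper_le G.e_mem_generated

/-- Brackets only involve the span of the coroots. -/
theorem lie_mem_triangular_corootSpan {x x' : L} (hx : x ∈ G.generated) (hx' : x' ∈ G.generated) :
    ⁅x, x'⁆ ∈ G.triangular (corootSpan D) := by
  obtain ⟨y, hy, s, z, hz, rfl⟩ := G.exists_decomposition hx'
  rw [lie_add, lie_add]
  refine add_mem (add_mem ?_ ?_) ?_
  · exact G.lie_mem_triangular le_rfl hx (G.lower_le_triangular _ hy)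
  -- Here `t s` need not lie in the smaller triangular sum, so `x` is decomposed as well: the
  -- bracket of the two Cartan parts is zero, and the other brackets stay in `lower` and `upper`.
  · obtain ⟨y', hy', s', z', hz', rfl⟩ := G.exists_decomposition hx
    rw [add_lie, add_lie, G.t_t, add_zero, ← lie_skew, ← lie_skew z']
    exact add_mem (neg_mem (G.lie_t_mem_triangular _ s (G.lower_le_triangular _ hy')))
      (neg_mem (G.lie_t_mem_triangular _ s (G.upper_le_triangular _ hz')))
  · exact G.lie_mem_triangular le_rfl hx (G.upper_le_triangular _ hz)

/-! ### The grading by an element on which all simple roots equal 1 -/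

section Grading

/-- The positive integers, as complex numbers. -/
def posSet : Set ℂ := {c | ∃ k : ℕ, c = k + 1}

/-- The negative integers, as complex numbers. -/
def negSet : Set ℂ := {c | ∃ k : ℕ, c = -(k + 1)}

theorem zero_notMem_posSet : (0 : ℂ) ∉ posSet := by
  rintro ⟨k, hk⟩
  exact Nat.cast_add_one_ne_zero k hk.symm

theorem disjoint_negSet : Disjoint negSet ({0} ∪ posSet) := by
  rw [Set.disjoint_left]
  rintro _ ⟨k, rfl⟩ (h | ⟨l, h⟩)
  · have h' : ((k + 1 : ℕ) : ℂ) = 0 := by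
      push_cast; linear_combination -(Set.mem_singleton_iff.1 h)
    exact absurd (Nat.cast_eq_zero.1 h') (by omega)
  · have h' : ((k + 1 + (l + 1) : ℕ) : ℂ) = 0 := by push_cast; linear_combination -h
    exact absurd (Nat.cast_eq_zero.1 h') (by omega)

theorem lie_mem_eigenSum_ad {h : L} {I : Set ℂ} (hI : ∀ a ∈ I, ∀ b ∈ I, a + b ∈ I) {x y : L}
    (hx : x ∈ eigenSum (LieAlgebra.ad ℂ L h) I) (hy : y ∈ eigenSum (LieAlgebra.ad ℂ L h) I) :
    ⁅x, y⁆ ∈ eigenSum (LieAlgebra.ad ℂ L h) I := by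
  refine (eigenSum_le_iff (p := (eigenSum (LieAlgebra.ad ℂ L h) I).comap
    (LieModule.toEnd ℂ L L x))).2 (fun ν hν z hz => ?_) hy
  rw [Submodule.mem_comap, LieModule.toEnd_apply_apply, ← lie_skew]
  refine neg_mem ((eigenSum_le_iff (p := (eigenSum (LieAlgebra.ad ℂ L h) I).comap
    (LieModule.toEnd ℂ L L z))).2 (fun μ hμ u hu => ?_) hx)
  refine eigenspace_le_eigenSum _ (hI ν hν μ hμ) ?_
  rw [Module.End.mem_eigenspace_iff, LieAlgebra.ad_apply] at hz hu ⊢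
  rw [LieModule.toEnd_apply_apply, leibniz_lie, hz, hu, smul_lie, lie_smul, add_smul]

/-- The subalgebra formed by the sum of the eigenspaces of `ad h` for a set of eigenvalues closed
under addition. -/
def eigenSumSubalgebra (h : L) (I : Set ℂ) (hI : ∀ a ∈ I, ∀ b ∈ I, a + b ∈ I) :
    LieSubalgebra ℂ L :=
  { eigenSum (LieAlgebra.ad ℂ L h) I with
    lie_mem' := fun hx hy => lie_mem_eigenSum_ad hI hx hy }

/-- Each `e i a` has degree 1 for `ad (t h)`, and degrees add under brackets. -/
theorem upper_le_eigenSum {h : T} (hh : ∀ i, D.root i h = 1) :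
    G.upper.toSubmodule ≤ eigenSum (LieAlgebra.ad ℂ L (G.t h)) posSet := by
  have hI : ∀ a ∈ posSet, ∀ b ∈ posSet, a + b ∈ posSet := by
    rintro _ ⟨k, rfl⟩ _ ⟨l, rfl⟩
    exact ⟨k + l + 1, by push_cast; ring⟩
  refine G.upper_le (P := eigenSumSubalgebra (G.t h) posSet hI) fun i a => ?_
  refine eigenspace_le_eigenSum _ (I := posSet) (μ := 1) ⟨0, by simp⟩ ?_
  rw [Module.End.mem_eigenspace_iff, LieAlgebra.ad_apply, G.t_e, hh, one_mul, one_smul]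

theorem lower_le_eigenSum {h : T} (hh : ∀ i, D.root i h = 1) :
    G.lower.toSubmodule ≤ eigenSum (LieAlgebra.ad ℂ L (G.t h)) negSet := by
  have hI : ∀ a ∈ negSet, ∀ b ∈ negSet, a + b ∈ negSet := by
    rintro _ ⟨k, rfl⟩ _ ⟨l, rfl⟩
    exact ⟨k + l + 1, by push_cast; ring⟩
  refine G.lower_le (P := eigenSumSubalgebra (G.t h) negSet hI) fun i a => ?_
  refine eigenspace_le_eigenSum _ (I := negSet) (μ := -1) ⟨0, by simp⟩ ?_
  rw [Module.End.mem_eigenspace_iff, LieAlgebra.ad_apply, G.t_f, hh, one_mul, neg_smul, one_smul]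

/-- Uniqueness of triangular decompositions. -/
theorem eq_zero_of_lower_add_t_add_pos {h : T} (hh : ∀ i, D.root i h = 1) {y z : L} {s : T}
    (hy : y ∈ G.lower) (hz : z ∈ eigenSum (LieAlgebra.ad ℂ L (G.t h)) posSet)
    (hyz : y + G.t s + z = 0) : y = 0 ∧ G.t s = 0 := by
  have hs : G.t s ∈ eigenSum (LieAlgebra.ad ℂ L (G.t h)) {0} :=
    eigenspace_le_eigenSum _ (Set.mem_singleton 0)
      (by rw [Module.End.mem_eigenspace_iff, LieAlgebra.ad_apply, G.t_t, zero_smul])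
  have hy0 : y = 0 := by
    refine eq_zero_of_add_eq_zero disjoint_negSet (G.lower_le_eigenSum hh hy)
      (add_mem (eigenSum_mono _ Set.subset_union_left hs)
        (eigenSum_mono _ Set.subset_union_right hz)) ?_
    rw [← add_assoc, hyz]
  refine ⟨hy0, eq_zero_of_add_eq_zero (Set.disjoint_singleton_left.2 zero_notMem_posSet) hs hz ?_⟩
  rwa [hy0, zero_add] at hyz

end Grading

/-! ### Highest weight vectors and the levels below them -/

section HighestWeight

variable {V : Type*} [AddCommGroup V] [Module ℂ V]

/-- The linear map `ρ` is a representation of `L` on `V`, and `v` is a highest weight vector of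
weight `χ`. -/
structure IsHighestWeight (ρ : L →ₗ[ℂ] Module.End ℂ V) (χ : T → ℂ) (v : V) : Prop where
  map_lie : ∀ x y w, ρ ⁅x, y⁆ w = ρ x (ρ y w) - ρ y (ρ x w)
  e_eq_zero : ∀ i a, ρ (G.e i a) v = 0
  t_eq_smul : ∀ s, ρ (G.t s) v = χ s • v

/-- The elements of `L` mapping `p` to `q`, for `q ≤ p`. -/
def mapsToSubalgebra {ρ : L →ₗ[ℂ] Module.End ℂ V}
    (hρ : ∀ x y w, ρ ⁅x, y⁆ w = ρ x (ρ y w) - ρ y (ρ x w)) (p q : Submodule ℂ V) (hqp : q ≤ p) :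
    LieSubalgebra ℂ L where
  carrier := {x | ∀ w ∈ p, ρ x w ∈ q}
  zero_mem' w _ := by simp
  add_mem' hx hy w hw := by simpa using add_mem (hx w hw) (hy w hw)
  smul_mem' c x hx w hw := by simpa using q.smul_mem c (hx w hw)
  lie_mem' {x y} hx hy w hw := by
    rw [hρ]
    exact sub_mem (hx _ (hqp (hy w hw))) (hy _ (hqp (hx w hw)))

/-- The span of all `f i₁ a₁ ⋯ f iₖ aₖ v`. -/
def level (ρ : L →ₗ[ℂ] Module.End ℂ V) (v : V) : ℕ → Submodule ℂ V
  | 0 => Submodule.span ℂ {v}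
  | k + 1 => ⨆ i, Submodule.map₂ LinearMap.id (LinearMap.range (ρ ∘ₗ G.f i)) (level ρ v k)

/-- The sum of all levels. -/
def levels (ρ : L →ₗ[ℂ] Module.End ℂ V) (v : V) : Submodule ℂ V := ⨆ k, G.level ρ v k

/-- The sum of all levels except the highest. -/
def lowerLevels (ρ : L →ₗ[ℂ] Module.End ℂ V) (v : V) : Submodule ℂ V := ⨆ k, G.level ρ v (k + 1)

variable {ρ : L →ₗ[ℂ] Module.End ℂ V} {χ : T → ℂ} {v : V}

theorem level_succ_le {k : ℕ} {p : Submodule ℂ V} :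
    G.level ρ v (k + 1) ≤ p ↔ ∀ i a, ∀ w ∈ G.level ρ v k, ρ (G.f i a) w ∈ p := by
  rw [level, iSup_le_iff]
  refine forall_congr' fun i => ?_
  rw [Submodule.map₂_le]
  constructor
  · intro h a w hw
    exact h _ ⟨a, rfl⟩ w hw
  · rintro h _ ⟨a, rfl⟩ w hw
    exact h a w hw

theorem f_mem_level (i : ι) (a : A) {k : ℕ} {w : V} (hw : w ∈ G.level ρ v k) :
    ρ (G.f i a) w ∈ G.level ρ v (k + 1) :=
  G.level_succ_le.1 le_rfl i a w hw

theorem mem_level_zero : v ∈ G.level ρ v 0 := Submodule.mem_span_singleton_self v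

theorem level_le_levels (k : ℕ) : G.level ρ v k ≤ G.levels ρ v := le_iSup (G.level ρ v) k

theorem level_succ_le_lowerLevels (k : ℕ) : G.level ρ v (k + 1) ≤ G.lowerLevels ρ v :=
  le_iSup (fun k => G.level ρ v (k + 1)) k

theorem lowerLevels_le_levels : G.lowerLevels ρ v ≤ G.levels ρ v :=
  iSup_le fun k => G.level_le_levels (k + 1)

theorem mem_levels : v ∈ G.levels ρ v := G.level_le_levels 0 G.mem_level_zero

theorem f_mem_lowerLevels (i : ι) (a : A) {w : V} (hw : w ∈ G.levels ρ v) :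
    ρ (G.f i a) w ∈ G.lowerLevels ρ v := by
  have h : G.levels ρ v ≤ (G.lowerLevels ρ v).comap (ρ (G.f i a)) :=
    iSup_le fun k w hw => G.level_succ_le_lowerLevels k (G.f_mem_level i a hw)
  exact h hw

theorem levels_le_span_sup : G.levels ρ v ≤ Submodule.span ℂ {v} ⊔ G.lowerLevels ρ v := by
  refine iSup_le fun k => ?_
  cases k with
  | zero => exact le_sup_left
  | succ k => exact (G.level_succ_le_lowerLevels k).trans le_sup_right

variable {G}

theorem IsHighestWeight.t_mem_level (hv : G.IsHighestWeight ρ χ v) (s : T) {k : ℕ} {w : V}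
    (hw : w ∈ G.level ρ v k) : ρ (G.t s) w ∈ G.level ρ v k := by
  induction k generalizing w with
  | zero =>
    obtain ⟨c, rfl⟩ := Submodule.mem_span_singleton.1 hw
    rw [map_smul, hv.t_eq_smul]
    exact Submodule.smul_mem _ _ (Submodule.smul_mem _ _ G.mem_level_zero)
  | succ k ih =>
    refine (G.level_succ_le (p := (G.level ρ v (k + 1)).comap (ρ (G.t s)))).2
      (fun i a w hw => ?_) hw
    have h := hv.map_lie (G.t s) (G.f i a) w
    rw [G.t_f, map_neg, LinearMap.neg_apply] at h
    rw [Submodule.mem_comap, ← sub_add_cancel (ρ (G.t s) (ρ (G.f i a) w))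
      (ρ (G.f i a) (ρ (G.t s) w)), ← h]
    exact add_mem (neg_mem (G.f_mem_level _ _ hw)) (G.f_mem_level _ _ (ih hw))

theorem IsHighestWeight.e_mem_level (hv : G.IsHighestWeight ρ χ v) (i : ι) (a : A) {k : ℕ} {w : V}
    (hw : w ∈ G.level ρ v k) : ρ (G.e i a) w ∈ G.levels ρ v := by
  -- The induction needs the sharper fact that `e i a` raises by exactly one level, with zero as the
  -- level above the highest.
  suffices h : ∀ k, ∀ w ∈ G.level ρ v k,
      ρ (G.e i a) w ∈ (match k with | 0 => ⊥ | k + 1 => G.level ρ v k : Submodule ℂ V) by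
    have := h k w hw
    cases k with
    | zero => rw [(Submodule.mem_bot ℂ).1 this]; exact zero_mem _
    | succ k => exact G.level_le_levels k this
  clear hw w k
  intro k
  induction k with
  | zero =>
    intro w hw
    obtain ⟨c, rfl⟩ := Submodule.mem_span_singleton.1 hw
    rw [map_smul, hv.e_eq_zero, smul_zero]
    exact zero_mem _
  | succ k ih =>
    intro w hw
    refine (G.level_succ_le (p := (G.level ρ v k).comap (ρ (G.e i a)))).2
      (fun j b w hw => ?_) hw
    have h := hv.map_lie (G.e i a) (G.f j b) w
    rw [Submodule.mem_comap, ← sub_add_cancel (ρ (G.e i a) (ρ (G.f j b) w))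
      (ρ (G.f j b) (ρ (G.e i a) w)), ← h]
    refine add_mem ?_ ?_
    · by_cases hij : i = j
      · subst hij
        rw [G.e_f_same]
        exact hv.t_mem_level _ hw
      · rw [G.e_f_ne _ _ _ _ hij, map_zero]
        exact zero_mem _
    · cases k with
      | zero => rw [(Submodule.mem_bot ℂ).1 (ih w hw), map_zero]; exact zero_mem _
      | succ k => exact G.f_mem_level _ _ (ih w hw)

/-- The sum of all levels is a subrepresentation. -/
theorem IsHighestWeight.mem_levels_of_generated (hv : G.IsHighestWeight ρ χ v) {x : L}
    (hx : x ∈ G.generated) {w : V} (hw : w ∈ G.levels ρ v) : ρ x w ∈ G.levels ρ v := by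
  refine G.generated_le (P := mapsToSubalgebra hv.map_lie (G.levels ρ v) (G.levels ρ v) le_rfl)
    (fun i a w hw => ?_) (fun i a w hw => ?_) (fun s w hw => ?_) hx w hw
  · exact (iSup_le fun k w hw => hv.e_mem_level i a hw :
      G.levels ρ v ≤ (G.levels ρ v).comap (ρ (G.e i a))) hw
  · exact G.lowerLevels_le_levels (G.f_mem_lowerLevels i a hw)
  · exact (iSup_le fun k w hw => G.level_le_levels k (hv.t_mem_level s hw) :
      G.levels ρ v ≤ (G.levels ρ v).comap (ρ (G.t s))) hw

theorem IsHighestWeight.mem_lowerLevels_of_lower (hv : G.IsHighestWeight ρ χ v) {x : L}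
    (hx : x ∈ G.lower) {w : V} (hw : w ∈ G.levels ρ v) : ρ x w ∈ G.lowerLevels ρ v :=
  G.lower_le (P := mapsToSubalgebra hv.map_lie (G.levels ρ v) (G.lowerLevels ρ v)
    G.lowerLevels_le_levels) (fun i a _ hw => G.f_mem_lowerLevels i a hw) hx w hw

theorem IsHighestWeight.eq_zero_of_upper (hv : G.IsHighestWeight ρ χ v) {x : L}
    (hx : x ∈ G.upper) : ρ x v = 0 := by
  refine (Submodule.mem_bot ℂ).1 (G.upper_le (P := mapsToSubalgebra hv.map_lie
    (Submodule.span ℂ {v}) ⊥ bot_le) (fun i a w hw => ?_) hx v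
      (Submodule.mem_span_singleton_self v))
  obtain ⟨c, rfl⟩ := Submodule.mem_span_singleton.1 hw
  rw [map_smul, hv.e_eq_zero, smul_zero]
  exact zero_mem _

theorem IsHighestWeight.level_le_eigenspace (hv : G.IsHighestWeight ρ χ v) {h : T}
    (hh : ∀ i, D.root i h = 1) (k : ℕ) :
    G.level ρ v k ≤ (ρ (G.t h)).eigenspace (χ h - k) := by
  induction k with
  | zero =>
    rw [level, Submodule.span_singleton_le_iff_mem, Module.End.mem_eigenspace_iff, hv.t_eq_smul]
    simp
  | succ k ih =>
    refine G.level_succ_le.2 fun i a w hw => ?_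
    have hw' := ih hw
    rw [Module.End.mem_eigenspace_iff] at hw' ⊢
    have h := hv.map_lie (G.t h) (G.f i a) w
    rw [G.t_f, hh, one_mul, map_neg, LinearMap.neg_apply, hw', map_smul] at h
    rw [eq_add_of_sub_eq h.symm]
    push_cast
    module

theorem IsHighestWeight.lowerLevels_le_eigenSum (hv : G.IsHighestWeight ρ χ v) {h : T}
    (hh : ∀ i, D.root i h = 1) :
    G.lowerLevels ρ v ≤ (ρ (G.t h)).eigenSum {c | ∃ k : ℕ, c = χ h - (k + 1 : ℕ)} :=
  iSup_le fun k => (hv.level_le_eigenspace hh (k + 1)).trans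
    (eigenspace_le_eigenSum _ ⟨k, rfl⟩)

/-- An ideal mapping a highest weight vector to lower levels maps everything to lower levels. -/
theorem IsHighestWeight.mem_lowerLevels_of_ideal (hv : G.IsHighestWeight ρ χ v) {J : Set L}
    (hJ : ∀ y ∈ J, ∀ i a, ⁅y, G.f i a⁆ ∈ J) (hJv : ∀ y ∈ J, ρ y v ∈ G.lowerLevels ρ v)
    {y : L} (hy : y ∈ J) {w : V} (hw : w ∈ G.levels ρ v) : ρ y w ∈ G.lowerLevels ρ v := by
  -- In `y f w = [y, f] w + f y w` the bracket is a new element of `J`, so the induction has to run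
  -- over all `y ∈ J` at once.
  suffices h : ∀ k, ∀ y ∈ J, G.level ρ v k ≤ (G.lowerLevels ρ v).comap (ρ y) from
    (iSup_le fun k => h k y hy : G.levels ρ v ≤ (G.lowerLevels ρ v).comap (ρ y)) hw
  intro k
  induction k with
  | zero =>
    intro y hy
    rw [level, Submodule.span_singleton_le_iff_mem]
    exact hJv y hy
  | succ k ih =>
    intro y hy
    refine G.level_succ_le.2 fun i a w hw => ?_
    have h := hv.map_lie y (G.f i a) w
    rw [Submodule.mem_comap, eq_add_of_sub_eq h.symm]
    exact add_mem (ih _ (hJ y hy i a) hw)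
      (G.f_mem_lowerLevels i a (G.lowerLevels_le_levels (ih y hy hw)))

/-- The vector `v` has eigenvalue `χ h` for `t h`, while the lower levels only have eigenvalues `χ h
- (k + 1)`; an invariant subspace splits accordingly. -/
theorem IsHighestWeight.smul_mem_of_add_mem (hv : G.IsHighestWeight ρ χ v) {h : T}
    (hh : ∀ i, D.root i h = 1) {p : Submodule ℂ V} (hp : ∀ w ∈ p, ρ (G.t h) w ∈ p)
    {c : ℂ} {w : V} (hw : w ∈ G.lowerLevels ρ v) (hcw : c • v + w ∈ p) : c • v ∈ p := by
  refine mem_of_add_mem_of_invariant hp (μ := χ h) ?_ ?_ (hv.lowerLevels_le_eigenSum hh hw) hcw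
  · rintro ⟨k, hk⟩
    have : ((k + 1 : ℕ) : ℂ) = 0 := by linear_combination hk
    exact absurd (Nat.cast_eq_zero.1 this) (by omega)
  · rw [Module.End.mem_eigenspace_iff, map_smul, hv.t_eq_smul, smul_comm]

/-- Levels are finite-dimensional if only finitely many operators `ρ (f i a)` are independent. -/
theorem level_fg [Finite ι] (hf : ∀ i, (LinearMap.range (ρ ∘ₗ G.f i)).FG) (k : ℕ) :
    (G.level ρ v k).FG := by
  induction k with
  | zero => exact Submodule.fg_span_singleton v
  | succ k ih => exact Submodule.fg_iSup _ fun i => (hf i).map₂ _ ih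

/-- If the levels are finite-dimensional and exhaust the representation, then so are the
eigenspaces of the grading element. -/
theorem IsHighestWeight.finiteDimensional_eigenspace (hv : G.IsHighestWeight ρ χ v) {h : T}
    (hh : ∀ i, D.root i h = 1) (hfg : ∀ k, (G.level ρ v k).FG) (htop : G.levels ρ v = ⊤) (μ : ℂ) :
    FiniteDimensional ℂ ((ρ (G.t h)).eigenspace μ) := by
  -- The levels with eigenvalue `μ` are separated from all others. The numbers `χ h - k` are
  -- distinct, so `p` is a single level or zero.
  let p : Submodule ℂ V := ⨆ (k : ℕ) (_ : χ h - k = μ), G.level ρ v k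
  let q : Submodule ℂ V := ⨆ (k : ℕ) (_ : χ h - k ≠ μ), G.level ρ v k
  have hp : p ≤ (ρ (G.t h)).eigenspace μ :=
    iSup₂_le fun k hk => hk ▸ hv.level_le_eigenspace hh k
  have hq : q ≤ (ρ (G.t h)).eigenSum {μ}ᶜ :=
    iSup₂_le fun k hk => (hv.level_le_eigenspace hh k).trans (eigenspace_le_eigenSum _ hk)
  have hpq : G.levels ρ v ≤ p ⊔ q := by
    refine iSup_le fun k => ?_
    by_cases hk : χ h - k = μ
    · exact le_sup_of_le_left (le_iSup₂_of_le (f := fun (k : ℕ) (_ : χ h - k = μ) => G.level ρ v k)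
        k hk le_rfl)
    · exact le_sup_of_le_right (le_iSup₂_of_le (f := fun (k : ℕ) (_ : χ h - k ≠ μ) => G.level ρ v k)
        k hk le_rfl)
  have hle : (ρ (G.t h)).eigenspace μ ≤ p := by
    intro x hx
    obtain ⟨y, hy, z, hz, rfl⟩ := Submodule.mem_sup.1 (hpq (htop ▸ Submodule.mem_top (x := x)))
    have hz' : z ∈ (ρ (G.t h)).eigenspace μ := by
      simpa using sub_mem hx (hp hy)
    have hz0 : z = 0 := eq_zero_of_add_eq_zero (I := {μ}ᶜ) (J := {μ}) disjoint_compl_left (hq hz)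
      (eigenspace_le_eigenSum _ (Set.mem_singleton μ) (neg_mem hz')) (add_neg_cancel z)
    rwa [hz0, add_zero]
  have hfin : FiniteDimensional ℂ p := by
    by_cases hk : ∃ k : ℕ, χ h - k = μ
    · obtain ⟨k, hk⟩ := hk
      have : FiniteDimensional ℂ (G.level ρ v k) := Module.Finite.iff_fg.2 (hfg k)
      refine Submodule.finiteDimensional_of_le (S₂ := G.level ρ v k) (iSup₂_le fun l hl => ?_)
      have : l = k := by
        have h' : (l : ℂ) = k := by linear_combination hk - hl
        exact_mod_cast h'
      rw [this]
    · have : p = ⊥ := eq_bot_iff.2 (iSup₂_le fun l hl => absurd ⟨l, hl⟩ hk)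
      rw [this]
      infer_instance
  exact Submodule.finiteDimensional_of_le hle

end HighestWeight

end ChevalleyGenerators

/-! ### Existence of highest weight representations, by operators on words -/

namespace RootDatumOver

noncomputable section

variable {ι A T β : Type*} [CommRing A] [Algebra ℂ A] [AddCommGroup T] [Module ℂ T]

/-- The tensor algebra on `ι × A`, spanned by the words in `ι × β` for a basis of `A` indexed by
`β`. -/
abbrev WordSpace (ι β : Type*) : Type _ := List (ι × β) →₀ ℂ

/-- The word `w` as an element of the space of words. -/
abbrev word (w : List (ι × β)) : WordSpace ι β := Finsupp.single w 1

/-- Left multiplication by `(i, a)`. -/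
def wordF (b : Module.Basis β ℂ A) (i : ι) : A →ₗ[ℂ] Module.End ℂ (WordSpace ι β) :=
  b.constr ℂ fun k => Finsupp.lmapDomain ℂ ℂ (List.cons (i, k))

theorem wordF_basis (b : Module.Basis β ℂ A) (i : ι) (k : β) (w : List (ι × β)) :
    wordF b i (b k) (word w) = word ((i, k) :: w) := by
  simp [wordF]

variable (D : RootDatumOver ι A T) (b : Module.Basis β ℂ A) (χ : T →ₗ[ℂ] ℂ)

/-- The action of `T` on a word. -/
def wordTAux : List (ι × β) → (T →ₗ[ℂ] WordSpace ι β)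
  | [] => χ.smulRight (word [])
  -- This is forced by `[t s, f i a] = -f i (root i s * a)`: move `t s` past the first letter.
  | (i, k) :: w => (wordF b i (b k)) ∘ₗ wordTAux w -
      ((wordF b i).flip (word w)) ∘ₗ LinearMap.mulRight ℂ (b k) ∘ₗ D.root i

/-- The action of `T` on words. -/
def wordT : T →ₗ[ℂ] Module.End ℂ (WordSpace ι β) :=
  (Finsupp.linearCombination ℂ (D.wordTAux b χ)).flip

open Classical in
/-- The action of `e j` on a word. -/
def wordEAux (j : ι) : List (ι × β) → (A →ₗ[ℂ] WordSpace ι β)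
  | [] => 0
  -- This is forced by `[e j a, f i c] = δ_{ij} t (coroot i (a * c))`, with `e j a` killing the
  -- empty word.
  | (i, k) :: w => (wordF b i (b k)) ∘ₗ wordEAux j w +
      if j = i then ((D.wordT b χ).flip (word w)) ∘ₗ D.coroot j ∘ₗ LinearMap.mulRight ℂ (b k) else 0

/-- The action of `e j` on words. -/
def wordE (j : ι) : A →ₗ[ℂ] Module.End ℂ (WordSpace ι β) :=
  (Finsupp.linearCombination ℂ (D.wordEAux b χ j)).flip

theorem wordT_word (s : T) (w : List (ι × β)) :
    D.wordT b χ s (word w) = D.wordTAux b χ w s := by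
  simp [wordT]

theorem wordE_word (j : ι) (a : A) (w : List (ι × β)) :
    D.wordE b χ j a (word w) = D.wordEAux b χ j w a := by
  simp [wordE]

theorem wordT_nil (s : T) : D.wordT b χ s (word []) = χ s • word [] := by
  rw [wordT_word]; rfl

theorem wordE_nil (j : ι) (a : A) : D.wordE b χ j a (word []) = 0 := by
  rw [wordE_word]; rfl

/-- Two families of linear operators depending linearly on `A` agree if they agree on basis
elements and words. -/
theorem word_bilin_ext {φ φ' : A →ₗ[ℂ] Module.End ℂ (WordSpace ι β)}
    (h : ∀ k w, φ (b k) (word w) = φ' (b k) (word w)) : φ = φ' := by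
  refine b.ext fun k => Finsupp.lhom_ext' fun w => LinearMap.ext_ring ?_
  exact h k w

theorem wordT_wordF (s : T) (i : ι) (a : A) (x : WordSpace ι β) :
    D.wordT b χ s (wordF b i a x) =
      wordF b i a (D.wordT b χ s x) - wordF b i (D.root i s * a) x := by
  have h : (wordF b i).compr₂ (D.wordT b χ s) + wordF b i ∘ₗ LinearMap.mulLeft ℂ (D.root i s) =
      (wordF b i).compl₂ (D.wordT b χ s) := by
    refine word_bilin_ext b fun k w => ?_
    simp only [LinearMap.compr₂_apply, wordF_basis, wordT_word, wordTAux, LinearMap.add_apply,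
      LinearMap.sub_apply, LinearMap.compl₂_apply, LinearMap.comp_apply, LinearMap.mulLeft_apply,
      LinearMap.mulRight_apply, LinearMap.flip_apply, sub_add_cancel]
  exact eq_sub_of_add_eq (LinearMap.congr_fun₂ h a x)

theorem wordE_wordF_same (i : ι) (a c : A) (x : WordSpace ι β) :
    D.wordE b χ i a (wordF b i c x) =
      wordF b i c (D.wordE b χ i a x) + D.wordT b χ (D.coroot i (a * c)) x := by
  have h : (wordF b i).compr₂ (D.wordE b χ i a) =
      (wordF b i).compl₂ (D.wordE b χ i a) +
        D.wordT b χ ∘ₗ D.coroot i ∘ₗ LinearMap.mulLeft ℂ a := by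
    refine word_bilin_ext b fun k w => ?_
    simp only [LinearMap.compr₂_apply, wordF_basis, wordE_word, wordEAux, LinearMap.add_apply,
      LinearMap.compl₂_apply, LinearMap.comp_apply, LinearMap.mulLeft_apply, if_true,
      LinearMap.mulRight_apply, LinearMap.flip_apply]
  exact LinearMap.congr_fun₂ h c x

theorem wordE_wordF_ne {i j : ι} (hij : i ≠ j) (a c : A) (x : WordSpace ι β) :
    D.wordE b χ i a (wordF b j c x) = wordF b j c (D.wordE b χ i a x) := by
  have h : (wordF b j).compr₂ (D.wordE b χ i a) = (wordF b j).compl₂ (D.wordE b χ i a) := by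
    refine word_bilin_ext b fun k w => ?_
    simp only [LinearMap.compr₂_apply, wordF_basis, wordE_word, wordEAux,
      LinearMap.compl₂_apply, LinearMap.comp_apply, if_neg hij, add_zero]
  exact LinearMap.congr_fun₂ h c x

/-- Operators on words agree if they agree on the empty word and have the same commutators with
all left multiplications. -/
theorem word_induction {φ φ' : Module.End ℂ (WordSpace ι β)}
    (h0 : φ (word []) = φ' (word []))
    (h : ∀ i k w, φ (word w) = φ' (word w) →
      φ (wordF b i (b k) (word w)) = φ' (wordF b i (b k) (word w))) : φ = φ' := by
  refine Finsupp.lhom_ext' fun w => LinearMap.ext_ring ?_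
  change φ (word w) = φ' (word w)
  induction w with
  | nil => exact h0
  | cons p w ih => have := h p.1 p.2 w ih; rwa [wordF_basis] at this

/-- The commutator of the two operators kills the empty word and, `A` being commutative, commutes
with every left multiplication. -/
theorem wordT_comm (s s' : T) :
    D.wordT b χ s * D.wordT b χ s' = D.wordT b χ s' * D.wordT b χ s := by
  refine word_induction b ?_ fun i k w ih => ?_
  · simp only [Module.End.mul_apply, wordT_nil, map_smul]
    rw [smul_comm]
  · simp only [Module.End.mul_apply] at ih ⊢
    simp only [wordT_wordF, map_sub, ih, mul_left_comm (D.root i s)]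
    abel

theorem wordT_wordE (s : T) (i : ι) (a : A) :
    D.wordT b χ s * D.wordE b χ i a =
      D.wordE b χ i a * D.wordT b χ s + D.wordE b χ i (D.root i s * a) := by
  refine word_induction b ?_ fun j k w ih => ?_
  · simp only [Module.End.mul_apply, LinearMap.add_apply, wordT_nil, wordE_nil, map_smul, map_zero,
      smul_zero, add_zero]
  · have hc := LinearMap.congr_fun (D.wordT_comm b χ s (D.coroot i (a * b k))) (word w)
    simp only [Module.End.mul_apply, LinearMap.add_apply] at ih hc ⊢
    by_cases hij : i = j
    · subst hij
      simp only [wordT_wordF, wordE_wordF_same, map_sub, map_add, ih, hc,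
        mul_left_comm a, mul_assoc]
      abel
    · simp only [wordT_wordF, D.wordE_wordF_ne b χ hij, map_sub, map_add, ih]
      abel

attribute [local instance] LieRing.ofAssociativeRing

variable {D} {L : Type*} [LieRing L] [LieAlgebra ℂ L]

/-- Generators of a Lie algebra paired with the corresponding operators on words. -/
def wordGenerators (G : ChevalleyGenerators D L) :
    ChevalleyGenerators D (L × Module.End ℂ (WordSpace ι β)) where
  e i := (G.e i).prod (D.wordE b χ i)
  f i := (G.f i).prod (wordF b i)
  t := G.t.prod (D.wordT b χ)
  e_f_same i a c := by
    refine Prod.ext (G.e_f_same i a c) (LinearMap.ext fun x => ?_)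
    change (D.wordE b χ i a * wordF b i c - wordF b i c * D.wordE b χ i a) x = _
    simp [wordE_wordF_same]
  e_f_ne i j a c hij := by
    refine Prod.ext (G.e_f_ne i j a c hij) (LinearMap.ext fun x => ?_)
    change (D.wordE b χ i a * wordF b j c - wordF b j c * D.wordE b χ i a) x = _
    simp [D.wordE_wordF_ne b χ hij]
  t_e s i a := by
    refine Prod.ext (G.t_e s i a) (LinearMap.ext fun x => ?_)
    exact sub_eq_of_eq_add' (LinearMap.congr_fun (D.wordT_wordE b χ s i a) x)
  t_f s i a := by
    refine Prod.ext (G.t_f s i a) (LinearMap.ext fun x => ?_)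
    change (D.wordT b χ s * wordF b i a - wordF b i a * D.wordT b χ s) x = _
    simp [wordT_wordF]
  t_t s s' := by
    refine Prod.ext (G.t_t s s') (LinearMap.ext fun x => ?_)
    exact sub_eq_zero_of_eq (LinearMap.congr_fun (D.wordT_comm b χ s s') x)

theorem isHighestWeight_word (G : ChevalleyGenerators D L) :
    (wordGenerators b χ G).IsHighestWeight (LinearMap.snd ℂ L (Module.End ℂ (WordSpace ι β))) χ
      (word []) where
  map_lie _ _ _ := rfl
  e_eq_zero i a := D.wordE_nil b χ i a
  t_eq_smul s := D.wordT_nil b χ s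

theorem levels_word_eq_top (G : ChevalleyGenerators D L) :
    (wordGenerators b χ G).levels (LinearMap.snd ℂ L (Module.End ℂ (WordSpace ι β))) (word []) =
      ⊤ := by
  refine eq_top_iff.2 fun x _ => ?_
  induction x using Finsupp.induction_linear with
  | zero => exact zero_mem _
  | add x y hx hy => exact add_mem (hx trivial) (hy trivial)
  | single w c =>
    rw [← mul_one c, ← smul_eq_mul, ← Finsupp.smul_single]
    refine Submodule.smul_mem _ c ?_
    induction w with
    | nil => exact ChevalleyGenerators.mem_levels _
    | cons p w ih =>
      have := ChevalleyGenerators.f_mem_lowerLevels (wordGenerators b χ G) p.1 (b p.2) (ih trivial)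
      rw [← Prod.mk.eta (p := p), ← word, ← wordF_basis b p.1 p.2 w]
      exact ChevalleyGenerators.lowerLevels_le_levels _ this

theorem lowerLevels_word_le (G : ChevalleyGenerators D L) :
    (wordGenerators b χ G).lowerLevels (LinearMap.snd ℂ L (Module.End ℂ (WordSpace ι β)))
      (word []) ≤ LinearMap.ker (Finsupp.lapply (R := ℂ) (M := ℂ) ([] : List (ι × β))) := by
  have h : ∀ i, (wordF b i).compr₂ (Finsupp.lapply (R := ℂ) (M := ℂ) ([] : List (ι × β))) = 0 := by
    intro i
    refine b.ext fun k => Finsupp.lhom_ext' fun w => LinearMap.ext_ring ?_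
    change (wordF b i (b k) (word w)) [] = 0
    rw [wordF_basis]
    exact Finsupp.single_eq_of_ne (by simp)
  exact iSup_le fun k => (ChevalleyGenerators.level_succ_le _).2
    fun i a w _ => LinearMap.congr_fun₂ (h i) a w

variable (G : ChevalleyGenerators D L)

theorem exists_mem_generated_fst_eq (hgen : G.generated = ⊤) (x : L) :
    ∃ y ∈ (wordGenerators b χ G).generated, y.1 = x := by
  have h : G.generated ≤ (wordGenerators b χ G).generated.map (LieHom.fst ℂ L _) :=
    G.generated_le
      (fun i a => ⟨_, (wordGenerators b χ G).e_mem_generated i a, rfl⟩)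
      (fun i a => ⟨_, (wordGenerators b χ G).f_mem_generated i a, rfl⟩)
      (fun s => ⟨_, (wordGenerators b χ G).t_mem_generated s, rfl⟩)
  exact h (hgen ▸ LieSubalgebra.mem_top x)

theorem fst_mem_lower {y : L × Module.End ℂ (WordSpace ι β)}
    (hy : y ∈ (wordGenerators b χ G).lower) : y.1 ∈ G.lower :=
  (wordGenerators b χ G).lower_le (P := G.lower.comap (LieHom.fst ℂ L _))
    (fun i a => G.f_mem_lower i a) hy

theorem fst_mem_upper {y : L × Module.End ℂ (WordSpace ι β)}
    (hy : y ∈ (wordGenerators b χ G).upper) : y.1 ∈ G.upper :=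
  (wordGenerators b χ G).upper_le (P := G.upper.comap (LieHom.fst ℂ L _))
    (fun i a => G.e_mem_upper i a) hy

/-- Operators on words representing zero have values without constant term. -/
theorem snd_apply_nil_eq_zero {h : T} (hh : ∀ i, D.root i h = 1) (hχ : ∀ s, G.t s = 0 → χ s = 0)
    {y : L × Module.End ℂ (WordSpace ι β)} (hy : y ∈ (wordGenerators b χ G).generated)
    (hy1 : y.1 = 0) (w : WordSpace ι β) : y.2 w [] = 0 := by
  have hv := isHighestWeight_word b χ G
  refine lowerLevels_word_le b χ G (hv.mem_lowerLevels_of_ideal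
    (J := {y | y ∈ (wordGenerators b χ G).generated ∧ y.1 = 0}) ?_ ?_ ⟨hy, hy1⟩
    (levels_word_eq_top b χ G ▸ Submodule.mem_top))
  · rintro y ⟨hy, hy1⟩ i a
    refine ⟨LieSubalgebra.lie_mem _ hy ((wordGenerators b χ G).f_mem_generated i a), ?_⟩
    change ⁅y.1, _⁆ = 0
    rw [hy1, zero_lie]
  · rintro y ⟨hy, hy1⟩
    -- The first coordinate is a vanishing triangular sum in `L`, so `t s = 0` there and hence `χ s
    -- = 0`. On the empty word only the `lower` part of the operator remains.
    obtain ⟨l, hl, s, u, hu, rfl⟩ := (wordGenerators b χ G).exists_decomposition hy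
    have hs := hχ s (G.eq_zero_of_lower_add_t_add_pos hh (fst_mem_lower b χ G hl)
      (G.upper_le_eigenSum hh (fst_mem_upper b χ G hu)) hy1).2
    rw [map_add, map_add, LinearMap.add_apply, LinearMap.add_apply, hv.t_eq_smul, hs, zero_smul,
      hv.eq_zero_of_upper hu, add_zero, add_zero]
    exact hv.mem_lowerLevels_of_lower hl (ChevalleyGenerators.mem_levels _)

/-- A Lie algebra generated by Chevalley generators has a representation with a highest weight
vector of any given weight. -/
theorem exists_highestWeight_representation (hgen : G.generated = ⊤) {h : T}
    (hh : ∀ i, D.root i h = 1) (hχ : ∀ s, G.t s = 0 → χ s = 0) (b : Module.Basis β ℂ A) :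
    ∃ (p : Submodule ℂ (WordSpace ι β)) (ρ : L →ₗ⁅ℂ⁆ Module.End ℂ (WordSpace ι β ⧸ p))
      (v : WordSpace ι β ⧸ p), v ≠ 0 ∧ G.IsHighestWeight (ρ : L →ₗ[ℂ] _) χ v := by
  -- `S` acts on words and maps onto `L`. The span `p` of the values of kernel operators is
  -- `S`-stable because the kernel is an ideal of `S`, so `L` acts on the quotient by `p`.
  let S := (wordGenerators b χ G).generated
  let p : Submodule ℂ (WordSpace ι β) :=
    Submodule.span ℂ {u | ∃ y ∈ S, y.1 = 0 ∧ ∃ w, u = y.2 w}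
  have hpε : p ≤ LinearMap.ker (Finsupp.lapply (R := ℂ) (M := ℂ) ([] : List (ι × β))) := by
    rw [Submodule.span_le]
    rintro _ ⟨y, hy, hy1, w, rfl⟩
    exact snd_apply_nil_eq_zero b χ G hh hχ hy hy1 w
  have hstab : ∀ y ∈ S, p ≤ p.comap y.2 := by
    intro y hy
    rw [Submodule.span_le]
    rintro _ ⟨z, hz, hz1, w, rfl⟩
    have h1 : y.2 (z.2 w) = (⁅y, z⁆).2 w + z.2 (y.2 w) := by
      change _ = (y.2 (z.2 w) - z.2 (y.2 w)) + _
      rw [sub_add_cancel]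
    change y.2 (z.2 w) ∈ p
    rw [h1]
    refine add_mem (Submodule.subset_span ⟨_, S.lie_mem hy hz, ?_, w, rfl⟩)
      (Submodule.subset_span ⟨z, hz, hz1, _, rfl⟩)
    change ⁅y.1, z.1⁆ = 0
    rw [hz1, lie_zero]
  have hsurj : Function.Surjective ((LinearMap.fst ℂ L (Module.End ℂ (WordSpace ι β))) ∘ₗ
      S.toSubmodule.subtype) := fun x => by
    obtain ⟨y, hy, h⟩ := exists_mem_generated_fst_eq b χ G hgen x
    exact ⟨⟨y, hy⟩, h⟩
  -- A linear section suffices: its failure to respect brackets lies in the kernel and disappears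
  -- modulo `p`.
  obtain ⟨σ, hσ⟩ := LinearMap.exists_rightInverse_of_surjective _ (LinearMap.range_eq_top.2 hsurj)
  have hσ1 : ∀ x, (σ x).1.1 = x := fun x => LinearMap.congr_fun hσ x
  have hzero : ∀ y ∈ S, y.1 = 0 → ∀ w, y.2 w ∈ p := fun y hy hy1 w =>
    Submodule.subset_span ⟨y, hy, hy1, w, rfl⟩
  have hσeq : ∀ y ∈ S, ∀ w, p.mkQ ((σ y.1).1.2 w) = p.mkQ (y.2 w) := fun y hy w => by
    rw [← sub_eq_zero, ← map_sub]
    refine (Submodule.Quotient.mk_eq_zero p).2 (hzero ((σ y.1).1 - y) (sub_mem (σ y.1).2 hy) ?_ w)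
    change (σ y.1).1.1 - y.1 = 0
    rw [hσ1, sub_self]
  let ρ : L →ₗ⁅ℂ⁆ Module.End ℂ (WordSpace ι β ⧸ p) :=
    { toFun := fun x => p.mapQ p (σ x).1.2 (hstab _ (σ x).2)
      map_add' := fun x y => Submodule.linearMap_qext _ (LinearMap.ext fun w => by
        simp only [LinearMap.comp_apply, map_add]; rfl)
      map_smul' := fun c x => Submodule.linearMap_qext _ (LinearMap.ext fun w => by
        simp only [LinearMap.comp_apply, map_smul]; rfl)
      map_lie' := fun {x y} => Submodule.linearMap_qext _ (LinearMap.ext fun w => by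
        have := hσeq ⁅(σ x).1, (σ y).1⁆ (S.lie_mem (σ x).2 (σ y).2) w
        rw [show (⁅(σ x).1, (σ y).1⁆).1 = ⁅x, y⁆ by
          change ⁅(σ x).1.1, (σ y).1.1⁆ = _
          rw [hσ1, hσ1]] at this
        exact this) }
  have hρ : ∀ y ∈ S, ∀ w, ρ y.1 (p.mkQ w) = p.mkQ (y.2 w) := hσeq
  refine ⟨p, ρ, p.mkQ (word []), fun h0 => ?_, fun x y w => ?_, fun i a => ?_, fun s => ?_⟩
  · have := hpε ((Submodule.Quotient.mk_eq_zero p).1 h0)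
    simp at this
  · change ρ ⁅x, y⁆ w = _
    rw [LieHom.map_lie]
    rfl
  · exact (hρ _ ((wordGenerators b χ G).e_mem_generated i a) _).trans
      ((congrArg p.mkQ (D.wordE_nil b χ i a)).trans (map_zero _))
  · exact (hρ _ ((wordGenerators b χ G).t_mem_generated s) _).trans
      ((congrArg p.mkQ (D.wordT_nil b χ s)).trans (map_smul _ _ _))

end

end RootDatumOver

/-! ### The Kac–Moody algebra: triangular decomposition, `h'` and `N⁺` -/

namespace CartanRealization

open Module.End ChevalleyGenerators

noncomputable section

variable {ι : Type uι} [Fintype ι] {C : Matrix ι ι ℤ}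
  {H : Type uH} [AddCommGroup H] [Module ℂ H] (R : CartanRealization C H)

/-- Linear independence of the roots gives a functional on the dual of `H` with value 1 on each of
them; by finite-dimensionality it is evaluation at a vector. -/
theorem exists_root_eq_one : ∃ h : H, ∀ i, R.root i h = 1 := by
  have := R.finiteDimensional
  obtain ⟨φ, hφ⟩ := LinearMap.exists_extend
    ((Finsupp.linearCombination ℂ (fun _ : ι => (1 : ℂ))) ∘ₗ
      (R.linearIndependent_root.repr : Submodule.span ℂ (Set.range R.root) →ₗ[ℂ] ι →₀ ℂ))
  refine ⟨(Module.evalEquiv ℂ H).symm φ, fun i => ?_⟩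
  have h1 : R.root i ((Module.evalEquiv ℂ H).symm φ) = φ (R.root i) := by simp
  have hi : R.root i ∈ Submodule.span ℂ (Set.range R.root) := Submodule.subset_span ⟨i, rfl⟩
  have h2 := LinearMap.congr_fun hφ ⟨R.root i, hi⟩
  rw [h1]
  refine h2.trans ?_
  rw [LinearMap.comp_apply, R.linearIndependent_root.repr_eq_single i ⟨R.root i, hi⟩ rfl]
  simp

/-- The projection of the free Lie algebra to the Kac-Moody algebra. -/
def freeToKacMoody : FreeLieAlgebra ℂ (Gen ι H) →ₗ⁅ℂ⁆ R.KacMoody where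
  toFun x := LieSubmodule.Quotient.mk (N := R.radIdeal)
    (LieSubmodule.Quotient.mk (N := R.relIdeal) x)
  map_add' _ _ := rfl
  map_smul' _ _ := rfl
  map_lie' := rfl

theorem freeToKacMoody_surjective : Function.Surjective R.freeToKacMoody := by
  intro x
  obtain ⟨y, rfl⟩ := LieSubmodule.Quotient.surjective_mk' R.radIdeal x
  obtain ⟨z, rfl⟩ := LieSubmodule.Quotient.surjective_mk' R.relIdeal y
  exact ⟨z, rfl⟩

theorem freeToKacMoody_eq_zero {x : FreeLieAlgebra ℂ (Gen ι H)} (hx : AuxRel R x) :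
    R.freeToKacMoody x = 0 := by
  have h : (LieSubmodule.Quotient.mk x : R.Aux) = 0 :=
    (LieSubmodule.Quotient.mk_eq_zero' ..).2 (LieSubmodule.subset_lieSpan hx)
  change LieSubmodule.Quotient.mk (N := R.radIdeal) (LieSubmodule.Quotient.mk x : R.Aux) = 0
  rw [h]
  rfl

theorem freeToKacMoody_genH (x : H) : R.freeToKacMoody (genH ι x) = R.toKacMoody x := rfl

/-- The root datum of a realization. -/
def rootDatum : RootDatumOver ι ℂ H where
  root := R.root
  coroot i := LinearMap.toSpanSingleton ℂ H (R.coroot i)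

/-- The Chevalley generators of the Kac-Moody algebra. -/
def generators : ChevalleyGenerators R.rootDatum R.KacMoody where
  e i := LinearMap.toSpanSingleton ℂ _ (R.freeToKacMoody (genE H i))
  f i := LinearMap.toSpanSingleton ℂ _ (R.freeToKacMoody (genF H i))
  t := R.toKacMoody
  e_f_same i a b := by
    have h := R.freeToKacMoody_eq_zero (AuxRel.e_f_same i)
    rw [map_sub, LieHom.map_lie, sub_eq_zero, freeToKacMoody_genH] at h
    simp [rootDatum, h, smul_smul, mul_comm]
  e_f_ne i j a b hij := by
    have h := R.freeToKacMoody_eq_zero (AuxRel.e_f_ne i j hij)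
    rw [LieHom.map_lie] at h
    simp [h]
  t_e s i a := by
    have h := R.freeToKacMoody_eq_zero (AuxRel.h_e s i)
    rw [map_sub, LieHom.map_lie, sub_eq_zero, freeToKacMoody_genH, map_smul] at h
    simp [rootDatum, h, smul_smul, mul_comm]
  t_f s i a := by
    have h := R.freeToKacMoody_eq_zero (AuxRel.h_f s i)
    rw [map_add, LieHom.map_lie, freeToKacMoody_genH, map_smul] at h
    simp [rootDatum, eq_neg_of_add_eq_zero_left h, smul_smul, mul_comm]
  t_t s s' := by
    have h := R.freeToKacMoody_eq_zero (AuxRel.h_h s s')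
    rwa [LieHom.map_lie, freeToKacMoody_genH, freeToKacMoody_genH] at h

theorem generated_generators : R.generators.generated = ⊤ := by
  let g : Gen ι H → R.generators.generated := fun x => match x with
    | .e i => ⟨_, R.generators.e_mem_generated i 1⟩
    | .f i => ⟨_, R.generators.f_mem_generated i 1⟩
    | .h x => ⟨_, R.generators.t_mem_generated x⟩
  have h : (R.generators.generated.incl).comp (FreeLieAlgebra.lift ℂ g) = R.freeToKacMoody := by
    refine FreeLieAlgebra.hom_ext fun x => ?_
    rw [LieHom.comp_apply, FreeLieAlgebra.lift_of_apply]
    cases x with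
    | e i => exact one_smul ℂ (R.freeToKacMoody (genE H i))
    | f i => exact one_smul ℂ (R.freeToKacMoody (genF H i))
    | h x => rfl
  refine eq_top_iff.2 fun x _ => ?_
  obtain ⟨y, rfl⟩ := R.freeToKacMoody_surjective x
  rw [← h]
  exact (FreeLieAlgebra.lift ℂ g y).2

theorem lie_mem_derived (x y : R.KacMoody) : ⁅x, y⁆ ∈ R.derived :=
  LieSubmodule.lie_mem_lie (LieSubmodule.mem_top x) (LieSubmodule.mem_top y)

/-- With `h` the grading element, `e i = [h, e i]`. -/
theorem e_mem_derived (i : ι) : R.generators.e i 1 ∈ R.derived := by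
  obtain ⟨h, hh⟩ := R.exists_root_eq_one
  have := R.generators.t_e h i 1
  rw [show R.rootDatum.root i h = 1 from hh i, one_mul] at this
  exact this ▸ R.lie_mem_derived _ _

theorem f_mem_derived (i : ι) : R.generators.f i 1 ∈ R.derived := by
  obtain ⟨h, hh⟩ := R.exists_root_eq_one
  have := R.generators.t_f h i 1
  rw [show R.rootDatum.root i h = 1 from hh i, one_mul] at this
  exact neg_neg (R.generators.f i 1) ▸ neg_mem (this ▸ R.lie_mem_derived _ _)

theorem coroot_mem_derived (i : ι) : R.toKacMoody (R.coroot i) ∈ R.derived := by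
  have := R.generators.e_f_same i 1 1
  simp only [rootDatum, mul_one, LinearMap.toSpanSingleton_apply, one_smul] at this
  exact this ▸ R.lie_mem_derived _ _

theorem derived_le_triangular :
    R.derived.toSubmodule ≤ R.generators.triangular (corootSpan R.rootDatum) := by
  rw [derived, LieSubmodule.lieIdeal_oper_eq_linear_span', Submodule.span_le]
  rintro _ ⟨x, -, y, -, rfl⟩
  exact R.generators.lie_mem_triangular_corootSpan
    (R.generated_generators ▸ LieSubalgebra.mem_top x)
    (R.generated_generators ▸ LieSubalgebra.mem_top y)

/-- The simple coroots, as elements of `h'`. -/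
def corootDerived (i : ι) : R.cartanDerived :=
  ⟨⟨R.toKacMoody (R.coroot i), R.coroot_mem_derived i⟩, ⟨R.coroot i, rfl⟩⟩

/-- An element of `g'` has a triangular decomposition with Cartan part in the span of the coroots.
If it also lies in `h`, uniqueness identifies it with that part. Uniqueness is used inside `g`, so
injectivity of `H → g` is not needed. -/
theorem span_range_corootDerived : Submodule.span ℂ (Set.range R.corootDerived) = ⊤ := by
  obtain ⟨h, hh⟩ := R.exists_root_eq_one
  refine eq_top_iff.2 fun ⟨⟨x, hx⟩, ⟨s', hs'⟩⟩ _ => ?_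
  have hs' : R.toKacMoody s' = x := hs'
  obtain ⟨y, hy, s, hs, z, hz, hx'⟩ := mem_triangular.1 (R.derived_le_triangular hx)
  have h0 := (R.generators.eq_zero_of_lower_add_t_add_pos hh (s := s - s') hy
    (R.generators.upper_le_eigenSum hh hz) (by
      rw [map_sub, show R.generators.t s' = x from hs', ← hx']; abel)).2
  have hxs : x = R.toKacMoody s := by
    rw [map_sub, sub_eq_zero] at h0
    exact hs'.symm.trans h0.symm
  have key : corootSpan R.rootDatum ≤ ((Submodule.span ℂ (Set.range R.corootDerived)).map
      (R.derived.toSubmodule.subtype ∘ₗ R.cartanDerived.subtype)).comap R.toKacMoody := by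
    refine iSup_le fun i => ?_
    rintro _ ⟨c, rfl⟩
    refine ⟨c • R.corootDerived i, Submodule.smul_mem _ c (Submodule.subset_span ⟨i, rfl⟩), ?_⟩
    simp only [rootDatum, LinearMap.toSpanSingleton_apply, map_smul]
    rfl
  obtain ⟨u, hu, hu'⟩ := key hs
  rwa [show (⟨⟨x, hx⟩, ⟨s', hs'⟩⟩ : R.cartanDerived) = u from
    Subtype.ext (Subtype.ext (hxs.trans hu'.symm))]

/-- This links `N⁺`, given by root spaces, with the algebra generated by the `e i`; it shows that
`N⁺ ⊗ A` kills any vector killed by all `e i ⊗ a`. -/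
theorem mem_upper_of_mem_nPos {x : R.derived} (hx : x ∈ R.nPos) :
    (x : R.KacMoody) ∈ R.generators.upper := by
  obtain ⟨h, hh⟩ := R.exists_root_eq_one
  have hx' : (x : R.KacMoody) ∈ eigenSum (LieAlgebra.ad ℂ _ (R.generators.t h)) posSet := by
    refine (iSup_le fun n => ?_ : (⨆ n : {n : ι → ℕ // n ≠ 0},
      R.rootSpace (∑ i, n.1 i • R.root i)) ≤ _) hx
    refine le_trans (fun y hy => ?_) (eigenspace_le_eigenSum _ (μ := ((∑ i, n.1 i : ℕ) : ℂ)) ?_)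
    · rw [Module.End.mem_eigenspace_iff, LieAlgebra.ad_apply]
      refine (hy h).trans ?_
      simp [hh]
    · have : ∑ i, n.1 i ≠ 0 := fun h0 => n.2 (funext fun i =>
        (Finset.sum_eq_zero_iff.1 h0) i (Finset.mem_univ i))
      obtain ⟨k, hk⟩ := Nat.exists_eq_succ_of_ne_zero this
      exact ⟨k, by rw [hk]; push_cast; rfl⟩
  -- Both `x` and `z` have positive degree, so `y + t s + (z - x) = 0` forces `y` and `t s` to
  -- vanish and `x = z`.
  obtain ⟨y, hy, s, z, hz, hx''⟩ := R.generators.exists_decomposition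
    (x := (x : R.KacMoody)) (R.generated_generators ▸ LieSubalgebra.mem_top _)
  obtain ⟨hy0, hs0⟩ := R.generators.eq_zero_of_lower_add_t_add_pos hh (s := s) hy
    (sub_mem (R.generators.upper_le_eigenSum hh hz) hx') (by rw [← hx'']; abel)
  rw [hy0, hs0, zero_add, zero_add] at hx''
  exact hx'' ▸ hz

/-- The element `e i` of `g'`. -/
def eDerived (i : ι) : R.derived := ⟨R.generators.e i 1, R.e_mem_derived i⟩

/-- The element `f i` of `g'`. -/
def fDerived (i : ι) : R.derived := ⟨R.generators.f i 1, R.f_mem_derived i⟩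

theorem eDerived_mem_nPos (i : ι) : R.eDerived i ∈ R.nPos := by
  classical
  refine Submodule.mem_iSup_of_mem (p := fun n : {n : ι → ℕ // n ≠ 0} =>
    R.rootSpace (∑ i, n.1 i • R.root i)) ⟨Pi.single i 1, by simp⟩ fun h => ?_
  have := R.generators.t_e h i 1
  simp only [rootDatum, mul_one] at this
  refine this.trans ?_
  have h2 : (∑ j, (Pi.single i 1 : ι → ℕ) j • R.root j) = R.root i := by
    rw [Finset.sum_eq_single i] <;> simp +contextual
  change _ = (∑ j, (Pi.single i 1 : ι → ℕ) j • R.root j) h • R.generators.e i 1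
  rw [h2, ← map_smul, smul_eq_mul, mul_one]

variable {R} {K : LieSubalgebra ℂ R.KacMoody}

/-- The sum map `h' × h'' → g`. -/
def addMap (R : CartanRealization C H) (K : LieSubalgebra ℂ R.KacMoody) :
    R.cartanDerived × K →ₗ[ℂ] R.KacMoody :=
  (R.derived.toSubmodule.subtype ∘ₗ R.cartanDerived.subtype).coprod K.toSubmodule.subtype

theorem addMap_injective (hK : R.IsComplement K) : Function.Injective (addMap R K) := by
  refine (injective_iff_map_eq_zero _).2 fun ⟨x, y⟩ h => ?_
  have h : ((x : R.derived) : R.KacMoody) + (y : R.KacMoody) = 0 := h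
  have hy : (y : R.KacMoody) = 0 := by
    have : (y : R.KacMoody) ∈ (R.cartan ⊓ R.derived.toSubmodule) ⊓ K.toSubmodule := by
      refine ⟨?_, y.2⟩
      rw [eq_neg_of_add_eq_zero_right h]
      exact neg_mem ⟨x.2, x.1.2⟩
    rwa [hK.disjoint, Submodule.mem_bot] at this
  rw [hy, add_zero] at h
  exact Prod.ext (Subtype.ext (Subtype.ext h)) (Subtype.ext hy)

theorem toKacMoody_mem_range_addMap (hK : R.IsComplement K) (h : H) :
    R.toKacMoody h ∈ LinearMap.range (addMap R K) := by
  have : R.toKacMoody h ∈ R.cartan := ⟨h, rfl⟩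
  rw [← hK.sup_eq] at this
  obtain ⟨x, hx, y, hy, hxy⟩ := Submodule.mem_sup.1 this
  exact ⟨(⟨⟨x, hx.2⟩, hx.1⟩, ⟨y, hy⟩), hxy⟩

theorem mem_cartan_of_mem (hK : R.IsComplement K) (y : K) : (y : R.KacMoody) ∈ R.cartan :=
  hK.sup_eq ▸ Submodule.mem_sup_right y.2

/-- The decomposition of elements of `H` according to `h = h' ⊕ h''`. -/
def split (hK : R.IsComplement K) : H →ₗ[ℂ] R.cartanDerived × K :=
  (LinearEquiv.ofInjective (addMap R K) (addMap_injective hK)).symm.toLinearMap ∘ₗ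
    R.toKacMoody.codRestrict _ (toKacMoody_mem_range_addMap hK)

theorem addMap_split (hK : R.IsComplement K) (h : H) : addMap R K (split hK h) = R.toKacMoody h :=
  congrArg Subtype.val ((LinearEquiv.ofInjective (addMap R K) (addMap_injective hK)).apply_symm_apply
    (R.toKacMoody.codRestrict _ (toKacMoody_mem_range_addMap hK) h))

theorem split_eq (hK : R.IsComplement K) {h : H} {x : R.cartanDerived × K}
    (hx : addMap R K x = R.toKacMoody h) : split hK h = x :=
  addMap_injective hK ((addMap_split hK h).trans hx.symm)

end

end CartanRealization

/-! ### Chevalley generators of the current algebra -/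

namespace CartanRealization

open Module.End ChevalleyGenerators

noncomputable section

variable {ι : Type uι} [Fintype ι] {C : Matrix ι ι ℤ}
  {H : Type uH} [AddCommGroup H] [Module ℂ H] {R : CartanRealization C H}
  {K : LieSubalgebra ℂ R.KacMoody} {A : Type uA} [CommRing A] [Algebra ℂ A]

variable (K) in
/-- The element `a ⊗ x` of the current algebra, linear in both arguments. -/
def tmulCurrent : A →ₗ[ℂ] R.derived →ₗ[ℂ] R.Current A K :=
  (TensorProduct.mk ℂ A R.derived).compr₂
    (LieAlgebra.SemiDirectSum.inl (R.currentAction A K)).toLinearMap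

theorem tmulCurrent_apply (a : A) (x : R.derived) :
    tmulCurrent K a x = (⟨a ⊗ₜ[ℂ] x, 0⟩ : R.Current A K) := rfl

theorem tmulCurrent_lie (a b : A) (x y : R.derived) :
    ⁅tmulCurrent K a x, tmulCurrent K b y⁆ = tmulCurrent K (a * b) ⁅x, y⁆ := by
  rw [tmulCurrent_apply, tmulCurrent_apply, tmulCurrent_apply,
    LieAlgebra.SemiDirectSum.lie_eq_mk]
  simp [LieAlgebra.ExtendScalars.bracket_tmul]

variable (A K) in
/-- The inclusion of `(A ⊗ h') ⊕ h''` in the current algebra as a linear map. -/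
def currentCartanLinear : (A ⊗[ℂ] R.cartanDerived) × K →ₗ[ℂ] R.Current A K where
  toFun := R.currentCartan A K
  map_add' x y := by simp [currentCartan]
  map_smul' c x := by simp [currentCartan]

/-- Tensoring over a field preserves injections. This makes `ψ` vanish wherever `t` does, as the
existence of a highest weight representation requires. -/
theorem currentCartan_injective : Function.Injective (R.currentCartan A K) := by
  intro s t h
  obtain ⟨h1, h2⟩ := LieAlgebra.SemiDirectSum.mk.inj h
  exact Prod.ext (Module.Flat.lTensor_preserves_injective_linearMap R.cartanDerived.subtype
    Subtype.val_injective h1) h2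

theorem currentCartan_tmul (a : A) (x : R.cartanDerived) :
    R.currentCartan A K (a ⊗ₜ[ℂ] x, 0) = tmulCurrent K a (x : R.derived) := rfl

theorem lie_inr_tmulCurrent (k : K) (a : A) (x : R.derived) :
    ⁅R.currentCartan A K (0, k), tmulCurrent K a x⁆ = tmulCurrent K a ⁅(k : R.KacMoody), x⁆ := by
  rw [tmulCurrent_apply, tmulCurrent_apply, currentCartan, LieAlgebra.SemiDirectSum.lie_eq_mk]
  simp [currentAction, LieIdeal.adDerivation]
  rfl

theorem lie_eq_zero_of_mem_cartan {x y : R.KacMoody} (hx : x ∈ R.cartan) (hy : y ∈ R.cartan) :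
    ⁅x, y⁆ = 0 := by
  obtain ⟨s, rfl⟩ := hx
  obtain ⟨s', rfl⟩ := hy
  exact R.generators.t_t s s'

theorem currentCartan_induction {p : Submodule ℂ (R.Current A K)}
    (h1 : ∀ a x, R.currentCartan A K (a ⊗ₜ[ℂ] x, 0) ∈ p)
    (h2 : ∀ k, R.currentCartan A K (0, k) ∈ p) (t) : R.currentCartan A K t ∈ p := by
  have h3 : ∀ u, currentCartanLinear K A (u, 0) ∈ p := by
    intro u
    induction u using TensorProduct.induction_on with
    | zero => rw [Prod.mk_zero_zero, map_zero]; exact zero_mem _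
    | tmul a x => exact h1 a x
    | add u v hu hv =>
      rw [← add_zero (0 : K), ← Prod.mk_add_mk, map_add]; exact add_mem hu hv
  have : currentCartanLinear K A t = currentCartanLinear K A (t.1, 0) +
      currentCartanLinear K A (0, t.2) := by
    rw [← map_add]; simp
  change currentCartanLinear K A t ∈ p
  rw [this]
  exact add_mem (h3 _) (h2 _)

theorem lie_currentCartan (hK : R.IsComplement K) (s t) :
    ⁅R.currentCartan A K s, R.currentCartan A K t⁆ = 0 := by
  have hd : ∀ (y : R.KacMoody), y ∈ R.cartan → ∀ x : R.cartanDerived, ⁅y, (x : R.derived)⁆ = 0 :=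
    fun y hy x => Subtype.ext (lie_eq_zero_of_mem_cartan hy x.2)
  refine currentCartan_induction
    (p := LinearMap.ker (LieModule.toEnd ℂ _ _ (R.currentCartan A K s))) (fun a x => ?_)
    (fun k => ?_) t
  · rw [LinearMap.mem_ker, LieModule.toEnd_apply_apply, ← lie_skew, neg_eq_zero]
    refine currentCartan_induction
      (p := LinearMap.ker (LieModule.toEnd ℂ _ _ (R.currentCartan A K (a ⊗ₜ[ℂ] x, 0))))
      (fun b y => ?_) (fun k => ?_) s
    · rw [LinearMap.mem_ker, LieModule.toEnd_apply_apply, currentCartan_tmul, currentCartan_tmul,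
        tmulCurrent_lie, show ⁅(x : R.derived), (y : R.derived)⁆ = 0 from hd _ x.2 y, map_zero]
    · rw [LinearMap.mem_ker, LieModule.toEnd_apply_apply, ← lie_skew, currentCartan_tmul,
        lie_inr_tmulCurrent, hd _ (mem_cartan_of_mem hK k), map_zero, neg_zero]
  · rw [LinearMap.mem_ker, LieModule.toEnd_apply_apply, ← lie_skew, neg_eq_zero]
    refine currentCartan_induction
      (p := LinearMap.ker (LieModule.toEnd ℂ _ _ (R.currentCartan A K (0, k))))
      (fun b y => ?_) (fun l => ?_) s
    · rw [LinearMap.mem_ker, LieModule.toEnd_apply_apply, currentCartan_tmul,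
        lie_inr_tmulCurrent, hd _ (mem_cartan_of_mem hK k), map_zero]
    · rw [LinearMap.mem_ker, LieModule.toEnd_apply_apply, currentCartan, currentCartan,
        LieAlgebra.SemiDirectSum.lie_eq_mk]
      have : ⁅k, l⁆ = 0 := Subtype.ext
        (lie_eq_zero_of_mem_cartan (mem_cartan_of_mem hK k) (mem_cartan_of_mem hK l))
      simp [this]

variable (R A) in
/-- The root datum over `A` on `(ι → A) × H`. -/
def currentRootDatum : RootDatumOver ι A ((ι → A) × H) where
  root i := (∑ j, R.root i (R.coroot j) • LinearMap.proj j).coprod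
    (Algebra.linearMap ℂ A ∘ₗ R.root i)
  coroot i := by
    classical exact LinearMap.inl ℂ _ _ ∘ₗ LinearMap.single ℂ (fun _ : ι => A) i

theorem currentRootDatum_root (i : ι) (s : (ι → A) × H) : (R.currentRootDatum A).root i s =
    ∑ j, R.root i (R.coroot j) • s.1 j + algebraMap ℂ A (R.root i s.2) := by
  simp [currentRootDatum, LinearMap.sum_apply]

variable (A) in
/-- The map `(ι → A) × H → (A ⊗ h') × h''`. -/
def toCartanPair (hK : R.IsComplement K) :
    (ι → A) × H →ₗ[ℂ] (A ⊗[ℂ] R.cartanDerived) × K :=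
  (LinearMap.inl ℂ _ _ ∘ₗ
      ∑ j, (TensorProduct.mk ℂ A R.cartanDerived).flip (R.corootDerived j) ∘ₗ
        LinearMap.proj j).coprod
    ((TensorProduct.mk ℂ A R.cartanDerived 1).prodMap LinearMap.id ∘ₗ split hK)

theorem toCartanPair_apply (hK : R.IsComplement K) (x : ι → A) (h : H) :
    toCartanPair A hK (x, h) =
      (∑ j, x j ⊗ₜ[ℂ] R.corootDerived j + 1 ⊗ₜ[ℂ] (split hK h).1, (split hK h).2) := by
  simp [toCartanPair]

/-- The space `(ι → A) × H` counts each `1 ⊗ coroot` twice, but the `A`-valued roots have an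
explicit formula on it. Surjectivity is enough to recover the whole of `(A ⊗ h') ⊕ h''`; for `A ⊗
h'` it rests on the coroots spanning `h'`. -/
theorem toCartanPair_surjective (hK : R.IsComplement K) :
    Function.Surjective (toCartanPair A hK) := by
  classical
  rw [← LinearMap.range_eq_top, eq_top_iff]
  have h1 : ∀ (a : A) (x : R.cartanDerived), (a ⊗ₜ[ℂ] x, (0 : K)) ∈
      LinearMap.range (toCartanPair A hK) := by
    intro a x
    have hx : x ∈ Submodule.span ℂ (Set.range R.corootDerived) :=
      R.span_range_corootDerived ▸ Submodule.mem_top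
    refine (Submodule.span_le.2 ?_ : _ ≤ (LinearMap.range (toCartanPair A hK)).comap
      (LinearMap.inl ℂ _ _ ∘ₗ TensorProduct.mk ℂ A R.cartanDerived a)) hx
    rintro _ ⟨i, rfl⟩
    refine ⟨(Pi.single i a, 0), ?_⟩
    rw [toCartanPair_apply, Finset.sum_eq_single i] <;> simp +contextual
  have h2 : ∀ u : A ⊗[ℂ] R.cartanDerived, (u, (0 : K)) ∈ LinearMap.range (toCartanPair A hK) := by
    intro u
    induction u using TensorProduct.induction_on with
    | zero => exact zero_mem _
    | tmul a x => exact h1 a x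
    | add u v hu hv => rw [← add_zero (0 : K), ← Prod.mk_add_mk]; exact add_mem hu hv
  rintro ⟨u, k⟩ _
  obtain ⟨h, hh⟩ := mem_cartan_of_mem hK k
  have hs : split hK h = (0, k) := split_eq hK (by rw [hh]; simp [addMap]; rfl)
  have h3 : ((0 : A ⊗[ℂ] R.cartanDerived), k) ∈ LinearMap.range (toCartanPair A hK) :=
    ⟨(0, h), by rw [toCartanPair_apply, hs]; simp⟩
  have := add_mem (h2 u) h3
  simpa using this

theorem lie_corootDerived (x : R.derived) {c : ℂ} {j : ι}
    (h : ⁅R.toKacMoody (R.coroot j), (x : R.KacMoody)⁆ = c • (x : R.KacMoody)) :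
    ⁅((R.corootDerived j : R.cartanDerived) : R.derived), x⁆ = c • x :=
  Subtype.ext h

/-- Stated for any weight vector `x`, so that `μ = root i` serves `e i` and `μ = -root i` serves `f
i`. -/
theorem lie_toCartanPair_tmulCurrent (hK : R.IsComplement K) {x : R.derived}
    {μ : H →ₗ[ℂ] ℂ} (hx : ∀ h, ⁅R.toKacMoody h, (x : R.KacMoody)⁆ = μ h • (x : R.KacMoody))
    (s : (ι → A) × H) (a : A) :
    ⁅currentCartanLinear K A (toCartanPair A hK s), tmulCurrent K a x⁆ =
      tmulCurrent K ((∑ j, μ (R.coroot j) • s.1 j + algebraMap ℂ A (μ s.2)) * a) x := by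
  obtain ⟨y, h⟩ := s
  have hsplit : toCartanPair A hK (y, h) =
      ∑ j, (y j ⊗ₜ[ℂ] R.corootDerived j, (0 : K)) + (1 ⊗ₜ[ℂ] (split hK h).1, 0) +
        (0, (split hK h).2) := by
    rw [toCartanPair_apply]
    refine Prod.ext ?_ ?_ <;> simp [Prod.fst_sum, Prod.snd_sum]
  -- The weight is a function on `H`, so the `h'` and `h''` components of `h` are recombined before
  -- their action on `x` is evaluated.
  have hl : ⁅((split hK h).1 : R.derived), x⁆ + ⁅((split hK h).2 : R.KacMoody), x⁆ = μ h • x := by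
    refine Subtype.ext ?_
    change ⁅(((split hK h).1 : R.derived) : R.KacMoody), (x : R.KacMoody)⁆ +
      ⁅((split hK h).2 : R.KacMoody), (x : R.KacMoody)⁆ = μ h • (x : R.KacMoody)
    rw [← add_lie, ← hx h, ← addMap_split hK h]
    rfl
  rw [hsplit, map_add, map_add, map_sum, add_lie, add_lie, sum_lie]
  have e1 : ∀ j, ⁅currentCartanLinear K A (y j ⊗ₜ[ℂ] R.corootDerived j, (0 : K)),
      tmulCurrent K a x⁆ = tmulCurrent K ((μ (R.coroot j) • y j) * a) x := fun j => by
    change ⁅tmulCurrent K (y j) (R.corootDerived j : R.derived), _⁆ = _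
    rw [tmulCurrent_lie, lie_corootDerived x (hx _), map_smul, smul_mul_assoc, map_smul,
      LinearMap.smul_apply]
  have e2 : ⁅currentCartanLinear K A (1 ⊗ₜ[ℂ] (split hK h).1, (0 : K)), tmulCurrent K a x⁆ =
      tmulCurrent K a ⁅((split hK h).1 : R.derived), x⁆ := by
    change ⁅tmulCurrent K 1 ((split hK h).1 : R.derived), _⁆ = _
    rw [tmulCurrent_lie, one_mul]
  have e3 : ⁅currentCartanLinear K A ((0 : A ⊗[ℂ] R.cartanDerived), (split hK h).2),
      tmulCurrent K a x⁆ = tmulCurrent K a ⁅((split hK h).2 : R.KacMoody), x⁆ :=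
    lie_inr_tmulCurrent _ _ _
  rw [Finset.sum_congr rfl fun j _ => e1 j, e2, e3, add_assoc, ← map_add, hl, add_mul,
    Finset.sum_mul, map_add, map_sum, LinearMap.add_apply, LinearMap.sum_apply, map_smul,
    ← Algebra.smul_def, map_smul, LinearMap.smul_apply]

theorem lie_toKacMoody_e (h : H) (i : ι) :
    ⁅R.toKacMoody h, (R.eDerived i : R.KacMoody)⁆ = R.root i h • (R.eDerived i : R.KacMoody) := by
  refine (R.generators.t_e h i 1).trans ?_
  rw [mul_one, ← mul_one (R.rootDatum.root i h), ← smul_eq_mul, map_smul]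
  rfl

theorem lie_toKacMoody_f (h : H) (i : ι) :
    ⁅R.toKacMoody h, (R.fDerived i : R.KacMoody)⁆ =
      (-R.root i) h • (R.fDerived i : R.KacMoody) := by
  refine (R.generators.t_f h i 1).trans ?_
  rw [mul_one, ← mul_one (R.rootDatum.root i h), ← smul_eq_mul, map_smul, ← neg_smul]
  rfl

theorem lie_eDerived_fDerived_same (i : ι) :
    ⁅R.eDerived i, R.fDerived i⁆ = (R.corootDerived i : R.derived) := by
  refine Subtype.ext ((R.generators.e_f_same i 1 1).trans ?_)
  simp only [rootDatum, mul_one, LinearMap.toSpanSingleton_apply, one_smul]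
  rfl

theorem lie_eDerived_fDerived_ne {i j : ι} (hij : i ≠ j) : ⁅R.eDerived i, R.fDerived j⁆ = 0 :=
  Subtype.ext (R.generators.e_f_ne i j 1 1 hij)

variable (A) in
/-- The Chevalley generators `e i ⊗ a`, `f i ⊗ a` of the current algebra. -/
def currentGenerators (hK : R.IsComplement K) :
    ChevalleyGenerators (R.currentRootDatum A) (R.Current A K) where
  e i := (tmulCurrent K).flip (R.eDerived i)
  f i := (tmulCurrent K).flip (R.fDerived i)
  t := currentCartanLinear K A ∘ₗ toCartanPair A hK
  e_f_same i a b := by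
    classical
    rw [LinearMap.flip_apply, LinearMap.flip_apply, tmulCurrent_lie, lie_eDerived_fDerived_same,
      ← currentCartan_tmul]
    refine congrArg (R.currentCartan A K) ?_
    change _ = toCartanPair A hK (Pi.single i (a * b), 0)
    rw [toCartanPair_apply, Finset.sum_eq_single i] <;> simp +contextual
  e_f_ne i j a b hij := by
    rw [LinearMap.flip_apply, LinearMap.flip_apply, tmulCurrent_lie, lie_eDerived_fDerived_ne hij,
      map_zero]
  t_e s i a := by
    rw [currentRootDatum_root]
    exact lie_toCartanPair_tmulCurrent hK (fun h => lie_toKacMoody_e h i) s a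
  t_f s i a := by
    have h : ∑ j, (-R.root i) (R.coroot j) • s.1 j + algebraMap ℂ A ((-R.root i) s.2) =
        -(∑ j, R.root i (R.coroot j) • s.1 j + algebraMap ℂ A (R.root i s.2)) := by
      simp only [LinearMap.neg_apply, neg_smul, Finset.sum_neg_distrib, map_neg, neg_add]
    refine (lie_toCartanPair_tmulCurrent hK (fun h => lie_toKacMoody_f h i) s a).trans ?_
    rw [h, neg_mul, map_neg, LinearMap.neg_apply, currentRootDatum_root]
    rfl
  t_t s s' := lie_currentCartan hK _ _

/-- The subalgebra of all `x ∈ g'` such that all `x ⊗ a` are in `Q`. -/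
def tensorSubalgebra (Q : LieSubalgebra ℂ (R.Current A K)) : LieSubalgebra ℂ R.KacMoody where
  carrier := {x | ∃ hx : x ∈ R.derived, ∀ a, tmulCurrent K a ⟨x, hx⟩ ∈ Q}
  zero_mem' := ⟨zero_mem _, fun a => by
    rw [show (⟨0, zero_mem _⟩ : R.derived) = 0 from rfl, map_zero]; exact zero_mem _⟩
  add_mem' := by
    rintro x y ⟨hx, hx'⟩ ⟨hy, hy'⟩
    refine ⟨add_mem hx hy, fun a => ?_⟩
    rw [show (⟨x + y, add_mem hx hy⟩ : R.derived) = ⟨x, hx⟩ + ⟨y, hy⟩ from rfl, map_add]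
    exact add_mem (hx' a) (hy' a)
  smul_mem' := by
    rintro c x ⟨hx, hx'⟩
    refine ⟨R.derived.smul_mem c hx, fun a => ?_⟩
    rw [show (⟨c • x, R.derived.smul_mem c hx⟩ : R.derived) = c • ⟨x, hx⟩ from rfl, map_smul]
    exact Q.smul_mem c (hx' a)
  lie_mem' := by
    rintro x y ⟨hx, hx'⟩ ⟨hy, hy'⟩
    refine ⟨R.lie_mem_derived x y, fun a => ?_⟩
    -- Since `A` is unital, `[x ⊗ a, y ⊗ 1]` already gives every `[x, y] ⊗ a`.
    have := Q.lie_mem (hx' a) (hy' 1)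
    rw [tmulCurrent_lie, mul_one] at this
    exact this

theorem tmulCurrent_mem_lower (hK : R.IsComplement K) {x : R.derived}
    (hx : (x : R.KacMoody) ∈ R.generators.lower) (a : A) :
    tmulCurrent K a x ∈ (currentGenerators A hK).lower := by
  refine (R.generators.lower_le (P := tensorSubalgebra (currentGenerators A hK).lower)
    (fun i c => ?_) hx).2 a
  rw [← mul_one c, ← smul_eq_mul, map_smul]
  exact LieSubalgebra.smul_mem _ c
    ⟨R.f_mem_derived i, fun a => (currentGenerators A hK).f_mem_lower i a⟩

theorem tmulCurrent_mem_upper (hK : R.IsComplement K) {x : R.derived}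
    (hx : (x : R.KacMoody) ∈ R.generators.upper) (a : A) :
    tmulCurrent K a x ∈ (currentGenerators A hK).upper := by
  refine (R.generators.upper_le (P := tensorSubalgebra (currentGenerators A hK).upper)
    (fun i c => ?_) hx).2 a
  rw [← mul_one c, ← smul_eq_mul, map_smul]
  exact LieSubalgebra.smul_mem _ c
    ⟨R.e_mem_derived i, fun a => (currentGenerators A hK).e_mem_upper i a⟩

/-- Elements of `g'` decompose according to `N⁻ ⊕ h' ⊕ N⁺`. -/
theorem derived_decomposition (x : R.derived) : ∃ (y : R.derived) (s : R.cartanDerived)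
    (z : R.derived), (y : R.KacMoody) ∈ R.generators.lower ∧
      (z : R.KacMoody) ∈ R.generators.upper ∧ x = y + s + z := by
  obtain ⟨y, hy, s, hs, z, hz, h⟩ := mem_triangular.1 (R.derived_le_triangular x.2)
  have hl : R.generators.lower ≤ LieIdeal.toLieSubalgebra ℂ _ R.derived :=
    R.generators.lower_le fun i c => by
      rw [← mul_one c, ← smul_eq_mul, map_smul]
      exact R.derived.smul_mem c (R.f_mem_derived i)
  have hu : R.generators.upper ≤ LieIdeal.toLieSubalgebra ℂ _ R.derived :=
    R.generators.upper_le fun i c => by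
      rw [← mul_one c, ← smul_eq_mul, map_smul]
      exact R.derived.smul_mem c (R.e_mem_derived i)
  have hs' : R.toKacMoody s ∈ R.derived := by
    have hs' : R.toKacMoody s = x - y - z := by rw [← h]; change R.generators.t s = _; abel
    rw [hs']
    exact sub_mem (sub_mem x.2 (hl hy)) (hu hz)
  exact ⟨⟨y, hl hy⟩, ⟨⟨_, hs'⟩, ⟨s, rfl⟩⟩, ⟨z, hu hz⟩, hy, hz, Subtype.ext h.symm⟩

theorem currentCartan_mem_generated (hK : R.IsComplement K) (t) :
    R.currentCartan A K t ∈ (currentGenerators A hK).generated := by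
  obtain ⟨s, rfl⟩ := toCartanPair_surjective hK t
  exact (currentGenerators A hK).t_mem_generated s

/-- A subspace of the current algebra is everything if it contains `A ⊗ g'` and `h''`. -/
theorem current_induction {p : Submodule ℂ (R.Current A K)} (h1 : ∀ a x, tmulCurrent K a x ∈ p)
    (h2 : ∀ k, R.currentCartan A K (0, k) ∈ p) (z : R.Current A K) : z ∈ p := by
  have h3 : ∀ u : A ⊗[ℂ] R.derived, LieAlgebra.SemiDirectSum.inl (R.currentAction A K) u ∈ p := by
    intro u
    induction u using TensorProduct.induction_on with
    | zero => rw [map_zero]; exact zero_mem _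
    | tmul a x => exact h1 a x
    | add u v hu hv => rw [map_add]; exact add_mem hu hv
  obtain ⟨u, k⟩ := z
  have := add_mem (h3 u) (h2 k)
  simpa [currentCartan] using this

theorem generated_currentGenerators (hK : R.IsComplement K) :
    (currentGenerators A hK).generated = ⊤ := by
  have h1 : ∀ (a : A) (x : R.derived), tmulCurrent K a x ∈ (currentGenerators A hK).generated := by
    intro a x
    obtain ⟨y, s, z, hy, hz, rfl⟩ := derived_decomposition x
    rw [map_add, map_add]
    refine add_mem (add_mem ?_ ?_) ?_
    · exact lower_le_generated _ (tmulCurrent_mem_lower hK hy a)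
    · exact currentCartan_mem_generated hK (a ⊗ₜ[ℂ] s, 0)
    · exact upper_le_generated _ (tmulCurrent_mem_upper hK hz a)
  exact eq_top_iff.2 fun z _ => current_induction
    (p := (currentGenerators A hK).generated.toSubmodule) h1
    (fun k => currentCartan_mem_generated hK (0, k)) z

/-- The grading element of the current algebra. -/
theorem exists_currentRoot_eq_one (R : CartanRealization C H) (A : Type uA) [CommRing A]
    [Algebra ℂ A] : ∃ s, ∀ i, (R.currentRootDatum A).root i s = 1 := by
  obtain ⟨h, hh⟩ := R.exists_root_eq_one
  exact ⟨(0, h), fun i => by simp [currentRootDatum, hh]⟩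

end

end CartanRealization

/-! ### Modules over the enveloping algebra as representations -/

namespace UniversalEnvelopingAlgebra

noncomputable section

variable {L : Type*} [LieRing L] [LieAlgebra ℂ L]

theorem mkAlgHom_surjective : Function.Surjective (mkAlgHom ℂ L) := fun u =>
  Quotient.inductionOn' u fun t => ⟨t, rfl⟩

variable {X : Type*} [AddCommGroup X] [Module ℂ X] [Module (UniversalEnvelopingAlgebra ℂ L) X]
  [IsScalarTower ℂ (UniversalEnvelopingAlgebra ℂ L) X]

variable (L X) in
/-- The action of a Lie algebra on a module over its enveloping algebra. -/
def rep : L →ₗ[ℂ] Module.End ℂ X :=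
  (Algebra.lsmul ℂ ℂ X : UniversalEnvelopingAlgebra ℂ L →ₐ[ℂ] Module.End ℂ X).toLinearMap ∘ₗ
    ((mkAlgHom ℂ L).toLinearMap ∘ₗ TensorAlgebra.ι ℂ)

theorem rep_apply (x : L) (w : X) : rep L X x w = ι ℂ x • w := rfl

theorem rep_lie (x y : L) (w : X) :
    rep L X ⁅x, y⁆ w = rep L X x (rep L X y w) - rep L X y (rep L X x w) := by
  have h : ι ℂ ⁅x, y⁆ = ι ℂ x * ι ℂ y - ι ℂ y * ι ℂ x :=
    letI := LieRing.ofAssociativeRing (A := UniversalEnvelopingAlgebra ℂ L)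
    LieHom.map_lie (ι ℂ) x y
  simp only [rep_apply, h, sub_smul, mul_smul]

/-- Subspaces stable under a Lie algebra are stable under its enveloping algebra. -/
theorem smul_mem_of_rep_mem {W : Submodule ℂ X} (hW : ∀ x : L, ∀ w ∈ W, rep L X x w ∈ W)
    (u : UniversalEnvelopingAlgebra ℂ L) {w : X} (hw : w ∈ W) : u • w ∈ W := by
  obtain ⟨t, rfl⟩ := mkAlgHom_surjective u
  induction t using TensorAlgebra.induction generalizing w with
  | algebraMap c => rw [AlgHom.commutes, algebraMap_smul]; exact W.smul_mem c hw
  | ι x => exact hW x w hw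
  | mul a b ha hb => rw [map_mul, mul_smul]; exact ha (hb hw)
  | add a b ha hb => rw [map_add, add_smul]; exact add_mem (ha hw) (hb hw)

/-- A stable subspace as a submodule over the enveloping algebra. -/
def stableSubmodule (W : Submodule ℂ X) (hW : ∀ x : L, ∀ w ∈ W, rep L X x w ∈ W) :
    Submodule (UniversalEnvelopingAlgebra ℂ L) X :=
  { W with smul_mem' := fun u _ hw => smul_mem_of_rep_mem hW u hw }

/-- The largest submodule contained in a subspace. -/
def largestSubmodule (W : Submodule ℂ X) : Submodule (UniversalEnvelopingAlgebra ℂ L) X where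
  carrier := {w | ∀ u : UniversalEnvelopingAlgebra ℂ L, u • w ∈ W}
  zero_mem' u := by simp
  add_mem' hx hy u := by simpa using add_mem (hx u) (hy u)
  smul_mem' c w hw u := by rw [← mul_smul]; exact hw (u * c)

end

end UniversalEnvelopingAlgebra

/-! ### Cyclic highest weight modules and their largest proper submodule -/

namespace ChevalleyGenerators

open UniversalEnvelopingAlgebra

variable {ι A T : Type*} [CommRing A] [Algebra ℂ A] [AddCommGroup T] [Module ℂ T]
  {D : RootDatumOver ι A T} {L : Type*} [LieRing L] [LieAlgebra ℂ L]
  {G : ChevalleyGenerators D L}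
  {X : Type*} [AddCommGroup X] [Module ℂ X] [Module (UniversalEnvelopingAlgebra ℂ L) X]
  [IsScalarTower ℂ (UniversalEnvelopingAlgebra ℂ L) X]
  {Y : Type*} [AddCommGroup Y] [Module ℂ Y] [Module (UniversalEnvelopingAlgebra ℂ L) Y]
  [IsScalarTower ℂ (UniversalEnvelopingAlgebra ℂ L) Y] {χ : T → ℂ} {v : X}

theorem IsHighestWeight.map (hv : G.IsHighestWeight (rep L X) χ v)
    (φ : X →ₗ[UniversalEnvelopingAlgebra ℂ L] Y) : G.IsHighestWeight (rep L Y) χ (φ v) where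
  map_lie := rep_lie
  e_eq_zero i a := by
    rw [rep_apply, ← map_smul, ← rep_apply, hv.e_eq_zero, map_zero]
  t_eq_smul s := by
    rw [rep_apply, ← map_smul, ← rep_apply, hv.t_eq_smul, φ.map_smul_of_tower]

theorem IsHighestWeight.levels_eq_top (hv : G.IsHighestWeight (rep L X) χ v)
    (hgen : G.generated = ⊤)
    (hX : ∀ x : X, ∃ u : UniversalEnvelopingAlgebra ℂ L, u • v = x) :
    G.levels (rep L X) v = ⊤ := by
  refine eq_top_iff.2 fun x _ => ?_
  obtain ⟨u, rfl⟩ := hX x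
  exact smul_mem_of_rep_mem
    (fun x w hw => hv.mem_levels_of_generated (hgen ▸ LieSubalgebra.mem_top x) hw) u G.mem_levels

theorem IsHighestWeight.notMem_lowerLevels (hv : G.IsHighestWeight (rep L X) χ v) {h : T}
    (hh : ∀ i, D.root i h = 1) (hv0 : v ≠ 0) : v ∉ G.lowerLevels (rep L X) v := by
  intro hv'
  refine hv0 ?_
  -- If `v` were in the lower levels, `v + (-v) = 0` would put its top component into the zero
  -- subspace.
  have := hv.smul_mem_of_add_mem hh (p := ⊥) (c := 1) (w := -v)
    (by rintro w hw; rw [(Submodule.mem_bot ℂ).1 hw, map_zero]; exact zero_mem _)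
    (neg_mem hv') (by rw [one_smul, add_neg_cancel]; exact zero_mem _)
  simpa using this

/-- Proper submodules of a highest weight module lie in the sum of the lower levels. -/
theorem IsHighestWeight.le_lowerLevels (hv : G.IsHighestWeight (rep L X) χ v)
    (hgen : G.generated = ⊤) {h : T} (hh : ∀ i, D.root i h = 1)
    (hX : ∀ x : X, ∃ u : UniversalEnvelopingAlgebra ℂ L, u • v = x)
    {N : Submodule (UniversalEnvelopingAlgebra ℂ L) X} (hN : N ≠ ⊤) {w : X} (hw : w ∈ N) :
    w ∈ G.lowerLevels (rep L X) v := by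
  have hw' : w ∈ Submodule.span ℂ {v} ⊔ G.lowerLevels (rep L X) v :=
    G.levels_le_span_sup (hv.levels_eq_top hgen hX ▸ Submodule.mem_top)
  obtain ⟨_, hcv, w', hl, rfl⟩ := Submodule.mem_sup.1 hw'
  obtain ⟨c, rfl⟩ := Submodule.mem_span_singleton.1 hcv
  -- The top component of an element of `N` lies in `N`; were it nonzero, `N` would contain the
  -- cyclic vector.
  have hc : c • v ∈ N := hv.smul_mem_of_add_mem hh (p := N.restrictScalars ℂ)
    (fun w hw => N.smul_mem _ hw) hl hw
  by_cases hc0 : c = 0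
  · rwa [hc0, zero_smul, zero_add]
  · refine absurd (eq_top_iff.2 fun x _ => ?_) hN
    obtain ⟨u, rfl⟩ := hX x
    refine N.smul_mem u ?_
    have := (N.restrictScalars ℂ).smul_mem c⁻¹ hc
    rwa [inv_smul_smul₀ hc0] at this

/-- The lower levels are in general not a submodule, so the sum is compared with the largest
submodule inside them. -/
theorem IsHighestWeight.sSup_le_lowerLevels (hv : G.IsHighestWeight (rep L X) χ v)
    (hgen : G.generated = ⊤) {h : T} (hh : ∀ i, D.root i h = 1)
    (hX : ∀ x : X, ∃ u : UniversalEnvelopingAlgebra ℂ L, u • v = x) {w : X}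
    (hw : w ∈ sSup {N : Submodule (UniversalEnvelopingAlgebra ℂ L) X | N ≠ ⊤}) :
    w ∈ G.lowerLevels (rep L X) v := by
  have : sSup {N : Submodule (UniversalEnvelopingAlgebra ℂ L) X | N ≠ ⊤} ≤
      largestSubmodule (G.lowerLevels (rep L X) v) :=
    sSup_le fun N hN w hw u => hv.le_lowerLevels hgen hh hX hN (N.smul_mem u hw)
  simpa using this hw 1

/-- An ideal mapping the highest weight vector to lower levels annihilates the quotient by the
largest proper submodule. -/
theorem IsHighestWeight.rep_quotient_eq_zero (hv : G.IsHighestWeight (rep L X) χ v)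
    (hgen : G.generated = ⊤) {h : T} (hh : ∀ i, D.root i h = 1)
    (hX : ∀ x : X, ∃ u : UniversalEnvelopingAlgebra ℂ L, u • v = x) (hv0 : v ≠ 0)
    {J : Submodule ℂ L} (hJ : ∀ x : L, ∀ y ∈ J, ⁅x, y⁆ ∈ J)
    (hJv : ∀ y ∈ J, rep L X y v ∈ G.lowerLevels (rep L X) v) {y : L} (hy : y ∈ J) :
    rep L (X ⧸ sSup {N : Submodule (UniversalEnvelopingAlgebra ℂ L) X | N ≠ ⊤}) y = 0 := by
  -- `W` is `J · X`: a submodule because `J` is an ideal, and proper because it lies in the lower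
  -- levels, which do not contain `v`.
  let W : Submodule ℂ X := Submodule.span ℂ {u | ∃ y ∈ J, ∃ w, u = rep L X y w}
  have hW : ∀ x : L, ∀ w ∈ W, rep L X x w ∈ W := by
    intro x w hw
    refine (Submodule.span_le.2 ?_ : _ ≤ W.comap (rep L X x)) hw
    rintro _ ⟨y, hy, w, rfl⟩
    change rep L X x (rep L X y w) ∈ W
    rw [eq_add_of_sub_eq (rep_lie x y w).symm]
    exact add_mem (Submodule.subset_span ⟨_, hJ x y hy, w, rfl⟩)
      (Submodule.subset_span ⟨y, hy, _, rfl⟩)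
  have hle : W ≤ G.lowerLevels (rep L X) v := by
    refine Submodule.span_le.2 ?_
    rintro _ ⟨y, hy, w, rfl⟩
    refine hv.mem_lowerLevels_of_ideal (J := J) (fun y hy i a => ?_) hJv hy
      (hv.levels_eq_top hgen hX ▸ Submodule.mem_top)
    rw [← lie_skew]
    exact neg_mem (hJ _ y hy)
  have hN : stableSubmodule W hW ≠ ⊤ := fun htop =>
    hv.notMem_lowerLevels hh hv0
      (hle (show v ∈ stableSubmodule W hW from htop ▸ Submodule.mem_top))
  refine LinearMap.ext fun x => ?_
  obtain ⟨w, rfl⟩ := Submodule.mkQ_surjective _ x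
  rw [rep_apply, ← map_smul]
  have hmem : stableSubmodule W hW ≤
      sSup {N : Submodule (UniversalEnvelopingAlgebra ℂ L) X | N ≠ ⊤} := le_sSup hN
  exact (Submodule.Quotient.mk_eq_zero _).2
    (hmem (show rep L X y w ∈ W from Submodule.subset_span ⟨y, hy, w, rfl⟩))

section Representation

variable {V : Type*} [AddCommGroup V] [Module ℂ V] {ρ : L →ₗ[ℂ] Module.End ℂ V} {v : V}

theorem IsHighestWeight.mem_lowerLevels_of_decomposition (hv : G.IsHighestWeight ρ χ v) {y z : L}
    {s : T} (hy : y ∈ G.lower) (hs : χ s = 0) (hz : z ∈ G.upper) :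
    ρ (y + G.t s + z) v ∈ G.lowerLevels ρ v := by
  rw [map_add, map_add, LinearMap.add_apply, LinearMap.add_apply, hv.eq_zero_of_upper hz,
    hv.t_eq_smul, hs, zero_smul, add_zero, add_zero]
  exact hv.mem_lowerLevels_of_lower hy G.mem_levels

theorem IsHighestWeight.t_f_apply (hv : G.IsHighestWeight ρ χ v) (s : T) (i : ι) (a : A) :
    ρ (G.t s) (ρ (G.f i a) v) = χ s • ρ (G.f i a) v - ρ (G.f i (D.root i s * a)) v := by
  rw [eq_add_of_sub_eq (hv.map_lie (G.t s) (G.f i a) v).symm, G.t_f, hv.t_eq_smul, map_smul,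
    map_neg, LinearMap.neg_apply]
  abel

theorem IsHighestWeight.t_f_apply_of_root_eq (hv : G.IsHighestWeight ρ χ v) {s : T} {i : ι} {c : ℂ}
    (hc : D.root i s = algebraMap ℂ A c) (a : A) :
    ρ (G.t s) (ρ (G.f i a) v) = (χ s - c) • ρ (G.f i a) v := by
  rw [hv.t_f_apply, hc, ← Algebra.smul_def, map_smul, map_smul, LinearMap.smul_apply, sub_smul]

theorem IsHighestWeight.e_f_apply (hv : G.IsHighestWeight ρ χ v) (i : ι) (a b : A) :
    ρ (G.e i a) (ρ (G.f i b) v) = χ (D.coroot i (a * b)) • v := by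
  rw [eq_add_of_sub_eq (hv.map_lie (G.e i a) (G.f i b) v).symm, G.e_f_same, hv.e_eq_zero,
    hv.t_eq_smul, map_zero, add_zero]

/-- Apply `t s` to `f i a v = 0` and commute it past `f i a`: only a nonzero multiple of `f i (b *
a) v` remains. -/
theorem IsHighestWeight.f_mul_eq_zero (hv : G.IsHighestWeight ρ χ v) {s : T} {i : ι} {a b : A}
    {c : ℂ} (hc : c ≠ 0) (hs : D.root i s = c • b) (ha : ρ (G.f i a) v = 0) :
    ρ (G.f i (b * a)) v = 0 := by
  have h := hv.t_f_apply s i a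
  rw [ha, map_zero, smul_zero, zero_sub, hs, smul_mul_assoc, map_smul, map_smul,
    LinearMap.smul_apply] at h
  exact (smul_eq_zero.1 (neg_eq_zero.1 h.symm)).resolve_left hc

end Representation

end ChevalleyGenerators

/-! ### The modules `M(ψ)` and `V(ψ)`, and the two implications -/

namespace CartanRealization

open Module.End ChevalleyGenerators UniversalEnvelopingAlgebra

noncomputable section

variable {ι : Type uι} [Fintype ι] {C : Matrix ι ι ℤ}
  {H : Type uH} [AddCommGroup H] [Module ℂ H] {R : CartanRealization C H}
  {K : LieSubalgebra ℂ R.KacMoody} {A : Type uA} [CommRing A] [Algebra ℂ A]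
  (ψ : ((A ⊗[ℂ] R.cartanDerived) × K) →ₗ[ℂ] ℂ)

/-- The highest weight vector of the induced module. -/
def vermaVector : Verma ψ := Submodule.Quotient.mk 1

theorem exists_smul_vermaVector (x : Verma ψ) : ∃ u : R.CurrentU A K, u • vermaVector ψ = x := by
  obtain ⟨u, rfl⟩ := Submodule.Quotient.mk_surjective _ x
  exact ⟨u, by rw [vermaVector, ← Submodule.Quotient.mk_smul, smul_eq_mul, mul_one]⟩

theorem isHighestWeight_vermaVector (hK : R.IsComplement K) :
    (currentGenerators A hK).IsHighestWeight (rep (R.Current A K) (Verma ψ))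
      (ψ ∘ₗ toCartanPair A hK) (vermaVector ψ) where
  map_lie := rep_lie
  e_eq_zero i a := by
    rw [rep_apply, vermaVector, ← Submodule.Quotient.mk_smul, smul_eq_mul, mul_one]
    exact (Submodule.Quotient.mk_eq_zero _).2
      (Submodule.subset_span (Or.inl ⟨a, _, R.eDerived_mem_nPos i, rfl⟩))
  t_eq_smul s := by
    rw [rep_apply, vermaVector, ← Submodule.Quotient.mk_smul, ← Submodule.Quotient.mk_smul,
      smul_eq_mul, mul_one]
    refine (Submodule.Quotient.eq _).2 ?_
    rw [← Algebra.algebraMap_eq_smul_one]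
    exact Submodule.subset_span (Or.inr ⟨toCartanPair A hK s, rfl⟩)

/-- The induced module is nonzero. -/
theorem vermaVector_ne_zero (hK : R.IsComplement K) : vermaVector ψ ≠ 0 := by
  obtain ⟨h, hh⟩ := exists_currentRoot_eq_one R A
  obtain ⟨p, ρ, v, hv0, hv⟩ := RootDatumOver.exists_highestWeight_representation
    (ψ ∘ₗ toCartanPair A hK) (currentGenerators A hK) (generated_currentGenerators hK) hh
    (fun s hs => by
      have : toCartanPair A hK s = 0 := currentCartan_injective
        (hs.trans (map_zero (currentCartanLinear K A)).symm)
      rw [LinearMap.comp_apply, this, map_zero]) (Module.Basis.ofVectorSpace ℂ A)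
  let Φ : R.CurrentU A K →ₐ[ℂ] Module.End ℂ _ := UniversalEnvelopingAlgebra.lift ℂ ρ
  have hΦ : ∀ x, Φ (UniversalEnvelopingAlgebra.ι ℂ x) = ρ x :=
    UniversalEnvelopingAlgebra.lift_ι_apply ℂ ρ
  -- The annihilator of a nonzero highest weight vector of weight `ψ` contains `vermaIdeal ψ` but
  -- not 1.
  let ann : Submodule (R.CurrentU A K) (R.CurrentU A K) :=
    { carrier := {u | Φ u v = 0}
      zero_mem' := by simp
      add_mem' := fun {u w} (hu : Φ u v = 0) (hw : Φ w v = 0) => by simp [hu, hw]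
      smul_mem' := fun c u (hu : Φ u v = 0) => by simp [hu] }
  have hle : vermaIdeal ψ ≤ ann := by
    refine Submodule.span_le.2 ?_
    rintro _ (⟨a, x, hx, rfl⟩ | ⟨t, rfl⟩)
    · change Φ (UniversalEnvelopingAlgebra.ι ℂ (tmulCurrent K a x)) v = 0
      rw [hΦ]
      exact hv.eq_zero_of_upper (tmulCurrent_mem_upper hK (R.mem_upper_of_mem_nPos hx) a)
    · obtain ⟨s, rfl⟩ := toCartanPair_surjective hK t
      change Φ (_ - _) v = 0
      rw [map_sub, hΦ, AlgHom.commutes, LinearMap.sub_apply, Module.algebraMap_end_apply]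
      exact sub_eq_zero_of_eq (hv.t_eq_smul s)
  intro h0
  have h1 : Φ 1 v = 0 := hle ((Submodule.Quotient.mk_eq_zero _).1 h0)
  rw [map_one] at h1
  exact hv0 h1

/-- The highest weight vector of the irreducible quotient. -/
def irrVector : Irr ψ := (maxSubmodule ψ).mkQ (vermaVector ψ)

theorem isHighestWeight_irrVector (hK : R.IsComplement K) :
    (currentGenerators A hK).IsHighestWeight (rep (R.Current A K) (Irr ψ))
      (ψ ∘ₗ toCartanPair A hK) (irrVector ψ) :=
  (isHighestWeight_vermaVector ψ hK).map (maxSubmodule ψ).mkQ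

theorem exists_smul_irrVector (x : Irr ψ) : ∃ u : R.CurrentU A K, u • irrVector ψ = x := by
  obtain ⟨x, rfl⟩ := (maxSubmodule ψ).mkQ_surjective x
  obtain ⟨u, rfl⟩ := exists_smul_vermaVector ψ x
  exact ⟨u, by rw [map_smul]; rfl⟩

/-- The sum of all proper submodules stays in the lower levels, which miss the highest weight vector
of `M(ψ)`. -/
theorem irrVector_ne_zero (hK : R.IsComplement K) : irrVector ψ ≠ 0 := by
  obtain ⟨h, hh⟩ := exists_currentRoot_eq_one R A
  have hv := isHighestWeight_vermaVector ψ hK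
  intro h0
  exact hv.notMem_lowerLevels hh (vermaVector_ne_zero ψ hK)
    (hv.sSup_le_lowerLevels (generated_currentGenerators hK) hh (exists_smul_vermaVector ψ)
      ((Submodule.Quotient.mk_eq_zero _).1 h0))

/-- Elements of `H` act on `V(ψ)` as the corresponding elements of `h`. -/
theorem t_eq_currentCartan (hK : R.IsComplement K) {h : H} {x : R.cartanDerived} {y : K}
    (hxy : R.toKacMoody h = ((x : R.derived) : R.KacMoody) + (y : R.KacMoody)) :
    (currentGenerators A hK).t (0, h) = R.currentCartan A K (1 ⊗ₜ[ℂ] x, y) := by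
  have hs : split hK h = (x, y) := split_eq hK hxy.symm
  change R.currentCartan A K (toCartanPair A hK (0, h)) = _
  rw [toCartanPair_apply, hs]
  simp

/-- The vectors `(f i ⊗ a) v` are weight vectors of a common weight. -/
theorem exists_f_mem_weightSpace (hK : R.IsComplement K) (i : ι) :
    ∃ μ : Module.Dual ℂ R.cartan, ∀ a : A,
      rep (R.Current A K) (Irr ψ) ((currentGenerators A hK).f i a) (irrVector ψ) ∈
        weightSpace ψ μ := by
  have hv := isHighestWeight_irrVector ψ hK
  obtain ⟨σ, hσ⟩ := LinearMap.exists_rightInverse_of_surjective R.toKacMoody.rangeRestrict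
    R.toKacMoody.range_rangeRestrict
  -- The weight is `ψ - α_i`. Weights live on the image of `H` in `g`, so it is transported by a
  -- linear section `σ` of `H → h`.
  refine ⟨(ψ ∘ₗ toCartanPair A hK ∘ₗ LinearMap.inr ℂ _ _ - R.root i) ∘ₗ σ, fun a => ?_⟩
  intro z x y hz
  have hz' : R.toKacMoody (σ z) = z := congrArg Subtype.val (LinearMap.congr_fun hσ z)
  refine (congrArg (fun x => rep (R.Current A K) (Irr ψ) x _)
    (t_eq_currentCartan hK (hz'.trans hz)).symm).trans
    (hv.t_f_apply_of_root_eq (c := R.root i (σ z)) ?_ a)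
  rw [currentRootDatum_root]
  simp

/-- Use `s = coroot i ⊗ b`, on which `root i` takes the value `C i i • b = 2 • b`. This makes the
annihilator in the next result an ideal. -/
theorem rep_f_mul_eq_zero (hC : IsGeneralizedCartanMatrix C) (hK : R.IsComplement K) (i : ι)
    {a : A} (ha : rep (R.Current A K) (Irr ψ) ((currentGenerators A hK).f i a) (irrVector ψ) = 0)
    (b : A) :
    rep (R.Current A K) (Irr ψ) ((currentGenerators A hK).f i (b * a)) (irrVector ψ) = 0 := by
  classical
  have hv := isHighestWeight_irrVector ψ hK
  refine hv.f_mul_eq_zero two_ne_zero (s := (Pi.single i b, 0)) ?_ ha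
  rw [currentRootDatum_root, Finset.sum_eq_single i]
  · simp [R.root_coroot, hC.diag]
  · intro j _ hj
    simp [hj]
  · simp

theorem exists_ideal_of_finiteDimensional (hC : IsGeneralizedCartanMatrix C)
    (hK : R.IsComplement K)
    (hfin : ∀ μ : Module.Dual ℂ R.cartan, FiniteDimensional ℂ (weightSpace ψ μ)) :
    ∃ I : Ideal A, FiniteDimensional ℂ (A ⧸ I) ∧
      ∀ a ∈ I, ∀ x : R.cartanDerived, ψ (a ⊗ₜ[ℂ] x, 0) = 0 := by
  classical
  have hv := isHighestWeight_irrVector ψ hK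
  let φ : ι → A →ₗ[ℂ] Irr ψ := fun i =>
    (rep (R.Current A K) (Irr ψ) ∘ₗ (currentGenerators A hK).f i).flip (irrVector ψ)
  choose μ hμ using exists_f_mem_weightSpace ψ hK
  -- All `i` are treated together: `Φ` lands in a finite product of finite-dimensional spaces and
  -- has kernel `I`, so `A ⧸ I` is finite-dimensional.
  let Φ : A →ₗ[ℂ] (∀ i, weightSpace ψ (μ i)) :=
    LinearMap.pi fun i => (φ i).codRestrict (weightSpace ψ (μ i)) (hμ i)
  let I : Ideal A :=
    { carrier := {a | ∀ i, φ i a = 0}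
      zero_mem' := fun i => map_zero _
      add_mem' := fun {a b} ha hb i => by rw [map_add, ha i, hb i, add_zero]
      smul_mem' := fun b a ha i => rep_f_mul_eq_zero ψ hC hK i (ha i) b }
  have hker : LinearMap.ker Φ = I.restrictScalars ℂ := by
    ext a
    constructor
    · intro ha i
      exact congrArg Subtype.val (congrFun ha i)
    · intro ha
      exact funext fun i => Subtype.ext (ha i)
  refine ⟨I, ?_, fun a ha x => ?_⟩
  · have h1 : FiniteDimensional ℂ (A ⧸ LinearMap.ker Φ) :=
      Module.Finite.equiv Φ.quotKerEquivRange.symm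
    rw [hker] at h1
    exact Module.Finite.equiv (Submodule.Quotient.restrictScalarsEquiv ℂ I)
  · have hx : x ∈ Submodule.span ℂ (Set.range R.corootDerived) :=
      R.span_range_corootDerived ▸ Submodule.mem_top
    refine (Submodule.span_le.2 ?_ : _ ≤ LinearMap.ker
      (ψ ∘ₗ LinearMap.inl ℂ _ _ ∘ₗ TensorProduct.mk ℂ A R.cartanDerived a)) hx
    rintro _ ⟨i, rfl⟩
    -- Applying `e i ⊗ 1` to `(f i ⊗ a) v = 0` gives `ψ (a ⊗ coroot i) • v = 0`, and `v` is nonzero.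
    have h := (hv.e_f_apply i 1 a).symm.trans ((congrArg _ (ha i)).trans (map_zero _))
    have h0 := (smul_eq_zero.1 h).resolve_right (irrVector_ne_zero ψ hK)
    change ψ (a ⊗ₜ[ℂ] R.corootDerived i, 0) = 0
    rw [← h0, one_mul]
    change _ = ψ (toCartanPair A hK (Pi.single i a, 0))
    rw [toCartanPair_apply, Finset.sum_eq_single i] <;> simp +contextual

variable (K) in
/-- The subspace `I ⊗ g'` of the current algebra. -/
def idealCurrent (I : Ideal A) : Submodule ℂ (R.Current A K) :=
  Submodule.span ℂ {y | ∃ a ∈ I, ∃ x : R.derived, y = tmulCurrent K a x}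

theorem tmulCurrent_mem_idealCurrent {I : Ideal A} {a : A} (ha : a ∈ I) (x : R.derived) :
    tmulCurrent K a x ∈ idealCurrent K I :=
  Submodule.subset_span ⟨a, ha, x, rfl⟩

theorem lie_mem_idealCurrent (I : Ideal A) (z : R.Current A K) {y : R.Current A K}
    (hy : y ∈ idealCurrent K I) : ⁅z, y⁆ ∈ idealCurrent K I := by
  refine (Submodule.span_le.2 ?_ : _ ≤ (idealCurrent K I).comap (LieModule.toEnd ℂ _ _ z)) hy
  rintro _ ⟨a, ha, x, rfl⟩
  change ⁅z, tmulCurrent K a x⁆ ∈ idealCurrent K I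
  rw [← lie_skew]
  refine neg_mem (current_induction
    (p := (idealCurrent K I).comap (LieModule.toEnd ℂ _ _ (tmulCurrent K a x)))
    (fun b x' => ?_) (fun k => ?_) z)
  · rw [Submodule.mem_comap, LieModule.toEnd_apply_apply, tmulCurrent_lie]
    exact tmulCurrent_mem_idealCurrent (I.mul_mem_right b ha) _
  · rw [Submodule.mem_comap, LieModule.toEnd_apply_apply, ← lie_skew, lie_inr_tmulCurrent]
    exact neg_mem (tmulCurrent_mem_idealCurrent ha _)

variable {ψ} in
-- Split `g'` triangularly: the negative part sends the vector to lower levels, `h' ⊗ I` acts on it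
-- by `ψ`, that is by zero, and the positive part kills it.
theorem rep_mem_lowerLevels_of_idealCurrent (hK : R.IsComplement K) {I : Ideal A}
    (hI : ∀ a ∈ I, ∀ x : R.cartanDerived, ψ (a ⊗ₜ[ℂ] x, 0) = 0) {y : R.Current A K}
    (hy : y ∈ idealCurrent K I) :
    rep (R.Current A K) (Verma ψ) y (vermaVector ψ) ∈
      (currentGenerators A hK).lowerLevels (rep (R.Current A K) (Verma ψ)) (vermaVector ψ) := by
  have hv := isHighestWeight_vermaVector ψ hK
  refine (Submodule.span_le.2 ?_ : _ ≤ (Submodule.comap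
    ((rep (R.Current A K) (Verma ψ)).flip (vermaVector ψ)) ((currentGenerators A hK).lowerLevels
      (rep (R.Current A K) (Verma ψ)) (vermaVector ψ)))) hy
  rintro _ ⟨a, ha, x, rfl⟩
  obtain ⟨y, s, z, hy, hz, rfl⟩ := derived_decomposition x
  obtain ⟨s', hs'⟩ := toCartanPair_surjective hK (a ⊗ₜ[ℂ] s, 0)
  have hs : (currentGenerators A hK).t s' = tmulCurrent K a (s : R.derived) :=
    congrArg (R.currentCartan A K) hs'
  have hχ : (ψ ∘ₗ toCartanPair A hK) s' = 0 := (congrArg ψ hs').trans (hI a ha s)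
  have hsum : tmulCurrent K a (y + s + z) =
      tmulCurrent K a y + (currentGenerators A hK).t s' + tmulCurrent K a z := by
    rw [hs, map_add, map_add]
  rw [hsum]
  exact hv.mem_lowerLevels_of_decomposition (tmulCurrent_mem_lower hK hy a) hχ
    (tmulCurrent_mem_upper hK hz a)

variable {ψ} in
/-- If `ψ` vanishes on `h' ⊗ I`, then `g' ⊗ I` annihilates `V(ψ)`. -/
theorem rep_irr_eq_zero_of_idealCurrent (hK : R.IsComplement K) {I : Ideal A}
    (hI : ∀ a ∈ I, ∀ x : R.cartanDerived, ψ (a ⊗ₜ[ℂ] x, 0) = 0) {y : R.Current A K}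
    (hy : y ∈ idealCurrent K I) : rep (R.Current A K) (Irr ψ) y = 0 := by
  obtain ⟨h, hh⟩ := exists_currentRoot_eq_one R A
  exact (isHighestWeight_vermaVector ψ hK).rep_quotient_eq_zero (generated_currentGenerators hK) hh
    (exists_smul_vermaVector ψ) (vermaVector_ne_zero ψ hK)
    (fun x _ hy => lie_mem_idealCurrent I x hy)
    (fun _ hy => rep_mem_lowerLevels_of_idealCurrent hK hI hy) hy

variable {ψ} in
theorem finiteDimensional_weightSpace (hK : R.IsComplement K) {I : Ideal A}
    [FiniteDimensional ℂ (A ⧸ I)]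
    (hI : ∀ a ∈ I, ∀ x : R.cartanDerived, ψ (a ⊗ₜ[ℂ] x, 0) = 0) (μ : Module.Dual ℂ R.cartan) :
    FiniteDimensional ℂ (weightSpace ψ μ) := by
  obtain ⟨h, hh⟩ := R.exists_root_eq_one
  have hh' : ∀ i, (R.currentRootDatum A).root i (0, h) = 1 := fun i => by
    simp [currentRootDatum_root, hh]
  have hv := isHighestWeight_irrVector ψ hK
  -- As `g' ⊗ I` acts by zero, `a ↦ f i ⊗ a` acts through `A ⧸ I`; hence the operators for each `i`
  -- span a finite-dimensional space, and so does each level.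
  have hfg : ∀ i, (LinearMap.range
      (rep (R.Current A K) (Irr ψ) ∘ₗ (currentGenerators A hK).f i)).FG := by
    intro i
    have hle : I.restrictScalars ℂ ≤
        LinearMap.ker (rep (R.Current A K) (Irr ψ) ∘ₗ (currentGenerators A hK).f i) := fun a ha =>
      rep_irr_eq_zero_of_idealCurrent hK hI (tmulCurrent_mem_idealCurrent ha _)
    have : FiniteDimensional ℂ (A ⧸ I.restrictScalars ℂ) :=
      Module.Finite.equiv (Submodule.Quotient.restrictScalarsEquiv ℂ I).symm
    rw [← Submodule.range_liftQ _ _ hle]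
    exact Module.Finite.iff_fg.1 inferInstance
  have hE := hv.finiteDimensional_eigenspace hh' (level_fg hfg)
    (hv.levels_eq_top (generated_currentGenerators hK) (exists_smul_irrVector ψ))
    (μ ⟨R.toKacMoody h, h, rfl⟩)
  -- The grading element belongs to `h`, so a weight space lies in a single one of its eigenspaces.
  have hle : weightSpace ψ μ ≤ (rep (R.Current A K) (Irr ψ)
      ((currentGenerators A hK).t (0, h))).eigenspace (μ ⟨R.toKacMoody h, h, rfl⟩) := fun w hw =>
    Module.End.mem_eigenspace_iff.2
      ((congrArg (fun x => rep (R.Current A K) (Irr ψ) x w)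
        (t_eq_currentCartan hK (addMap_split hK h).symm)).trans
        (hw ⟨R.toKacMoody h, h, rfl⟩ _ _ (addMap_split hK h).symm))
  exact Submodule.finiteDimensional_of_le hle

end

end CartanRealization

theorem lemma2p3 {ι : Type*} [Fintype ι] {C : Matrix ι ι ℤ}
    (hC : IsGeneralizedCartanMatrix C)
    {H : Type*} [AddCommGroup H] [Module ℂ H] (R : CartanRealization C H)
    (K : LieSubalgebra ℂ R.KacMoody) (hK : R.IsComplement K)
    {A : Type*} [CommRing A] [Algebra ℂ A] [Algebra.FiniteType ℂ A]
    (ψ : ((A ⊗[ℂ] R.cartanDerived) × K) →ₗ[ℂ] ℂ) :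
    (∀ μ : Module.Dual ℂ R.cartan,
        FiniteDimensional ℂ (CartanRealization.weightSpace ψ μ)) ↔
      ∃ I : Ideal A, FiniteDimensional ℂ (A ⧸ I) ∧
        ∀ a ∈ I, ∀ x : R.cartanDerived, ψ (a ⊗ₜ[ℂ] x, 0) = 0 := by
  constructor
  · exact CartanRealization.exists_ideal_of_finiteDimensional ψ hC hK
  · rintro ⟨I, hfin, hI⟩
    exact CartanRealization.finiteDimensional_weightSpace hK hI
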